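/- **Setting.** Fix a prompt. An intermediate state $s$ is drawn from a probability law $\nu$; given $s$, a final response $y$ is drawn from a probability law $\pi(\cdot\mid s)$, depending measurably on $s$, and has real reward $r(y)$. Let $F_s$ be the law of $r(y)$ for $y\sim\pi(\cdot\mid s)$, and let $V_n(s)=\mathbb E[\max_{1\le i\le n}R_i]$ with $R_1,\dots,R_n$ i.i.d. from $F_s$. The $p$-quantile of a law (or of a data set) is the generalized inverse $\inf\{x: F(x)\ge p\}$ of its (empirical) distribution function $F$. **Assumption.** Let $\alpha\in(0,1)$, $0<\sigma_{\min}\le\sigma_{\max}<\infty$ and $C_R,M_\mu\in\mathbb R$. There are functions $\mu(s),\sigma(s)$ such that for $\nu$-almost every $s$: on $[r_\alpha(s),\infty)$, where $r_\alpha(s)$ is the $(1-\alpha)$-quantile of $F_s$, the law $F_s$ has the density of $\mathcal N(\mu(s),\sigma(s)^2)$; $\mathbb E_{R\sim F_s}[R^2]\le C_R$; and $\sigma(s)\in[\sigma_{\min},\sigma_{\max}]$. Moreover $\mathbb E_{s\sim\nu}[\mu(s)^2]\le M_\mu$. **Prediction.** Let $\phi,\Phi$ be the standard normal density and distribution function,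 $\lambda(z)=\phi(z)/(1-\Phi(z))$, $\delta(z)=1+z\lambda(z)-\lambda(z)^2$, $z=\Phi^{-1}(1-\alpha/2)$, and let $E(N)$ be the expected maximum of $N$ i.i.d. standard normal variables. From $m$ rewards sampled at $s$, let $\hat\mu_{\rm tail}$ and $\hat\sigma^2_{\rm tail}$ be the mean and the variance (normalized by the number of tail points) of those rewards that are at least the empirical $(1-\alpha/2)$-quantile, and put $\hat\sigma=\sqrt{\hat\sigma_{\rm tail}^2/\delta(z)}$, $\hat\mu=\hat\mu_{\rm tail}-\hat\sigma\lambda(z)$, $\hat V_N(s)=\hat\mu+\hat\sigma E(N)$. **Algorithms.** SLG search with budget $N$, width $K$ and estimation sample size $m$ draws $K$ i.i.d. states $s_1,\dots,s_K\sim\nu$; draws $m$ independent responses from each $s_i$ and computes $\hat V_N(s_i)$ from their rewards; chooses $\hat I\in\operatorname{argmax}_i\hat V_N(s_i)$; and draws $N-Km$ further independent responses from $s_{\hat I}$. Its value $V_N(\mathcal A_{\rm SLG})$ is the expected maximum of the rewards of all responses generated (in both rounds). The full-information oracle $\mathcal A^*$ with budget $n$ draws $n$ i.i.d. states from $\nu$,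 chooses one of them that maximizes $V_n$, and draws $n$ independent responses from it; its value $V_n(\mathcal A^*)$ is the expected maximum of their rewards. Ties in both argmax are broken by arbitrary measurable rules. **Theorem.** There are constants $c_0,c>0$ depending only on $(\alpha,\sigma_{\min},\sigma_{\max},C_R,M_\mu)$ such that, under the assumption above, for all natural numbers $N,m$ with $N\ge 4(m+1)$ and $m\ge c_0\log N$, SLG search with sample size $m$ and width $K=\lfloor N/(2m)\rfloor$ satisfies $$V_N(\mathcal A_{\rm SLG})\;\ge\;V_{\lfloor N/(2m)\rfloor}(\mathcal A^*)-c\,\frac{\log N}{\sqrt m},$$ where both expectations exist (the two maxima are integrable). -/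

import Mathlib

open MeasureTheory ProbabilityTheory

universe u v

namespace SLG

/-! ### Quantiles, expected maxima, the Gaussian tail condition -/

/-- The quantile function (generalized inverse of the distribution function) of a law on `ℝ`. -/
noncomputable def quantile (F : Measure ℝ) (p : ℝ) : ℝ :=
  sInf {x : ℝ | p ≤ cdf F x}

/-- Expected maximum of `N` i.i.d. draws from the law `F` on `ℝ`. -/
noncomputable def expectedMax (F : Measure ℝ) (N : ℕ) : ℝ :=
  ∫ x : Fin N → ℝ, ⨆ i, x i ∂(Measure.pi fun _ : Fin N => F)

/-- Gaussian tail condition for a reward law `F`: on `[r_α, ∞)`, where `r_α` is the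
`(1 - α)`-quantile of `F`, the law `F` has the density of `𝒩(μ, σ²)`, and the second moment of
`F` is finite and at most `CR`. Nothing is required of `F` below `r_α`. -/
structure GaussianTail (α CR : ℝ) (F : Measure ℝ) (μ σ : ℝ) : Prop where
  tail : F.restrict (Set.Ici (quantile F (1 - α))) =
    (volume.withDensity (gaussianPDF μ (Real.toNNReal (σ ^ 2)))).restrict
      (Set.Ici (quantile F (1 - α)))
  integrable_sq : Integrable (fun r : ℝ => r ^ 2) F
  second_moment_le : ∫ r : ℝ, r ^ 2 ∂F ≤ CR

/-! ### Scaling-law prediction by tail extrapolation -/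

/-- The inverse Mills ratio `φ(z) / (1 - Φ(z))` of the standard normal law. -/
noncomputable def mills (z : ℝ) : ℝ :=
  gaussianPDFReal 0 1 z / (1 - cdf (gaussianReal 0 1) z)

/-- Variance `1 + z λ(z) - λ(z)²` of a standard normal variable conditioned to be `≥ z`. -/
noncomputable def truncVar (z : ℝ) : ℝ :=
  1 + z * mills z - mills z ^ 2

/-- The `p`-quantile of a finite data set: generalized inverse of its empirical distribution
function. -/
noncomputable def empQuantile {m : ℕ} (p : ℝ) (d : Fin m → ℝ) : ℝ :=
  sInf {x : ℝ | p ≤ ((Finset.univ.filter fun j => d j ≤ x).card : ℝ) / m}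

/-- Indices of the data points that are at least the empirical `(1 - α / 2)`-quantile. -/
noncomputable def tailSet {m : ℕ} (α : ℝ) (d : Fin m → ℝ) : Finset (Fin m) :=
  Finset.univ.filter fun j => empQuantile (1 - α / 2) d ≤ d j

/-- Sample mean of the tail data. -/
noncomputable def tailMean {m : ℕ} (α : ℝ) (d : Fin m → ℝ) : ℝ :=
  (∑ j ∈ tailSet α d, d j) / ((tailSet α d).card : ℝ)

/-- Sample variance of the tail data. -/
noncomputable def tailVar {m : ℕ} (α : ℝ) (d : Fin m → ℝ) : ℝ :=
  (∑ j ∈ tailSet α d, (d j - tailMean α d) ^ 2) / ((tailSet α d).card : ℝ)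

/-- The estimate `σ̂` obtained by inverting the truncated normal moments. -/
noncomputable def sigmaHat {m : ℕ} (α : ℝ) (d : Fin m → ℝ) : ℝ :=
  Real.sqrt (tailVar α d / truncVar (quantile (gaussianReal 0 1) (1 - α / 2)))

/-- The estimate `μ̂` obtained by inverting the truncated normal moments. -/
noncomputable def muHat {m : ℕ} (α : ℝ) (d : Fin m → ℝ) : ℝ :=
  tailMean α d - sigmaHat α d * mills (quantile (gaussianReal 0 1) (1 - α / 2))

/-- The predicted expected maximum `μ̂ + σ̂ E(N)` for budget `N` from the data `d`. -/
noncomputable def predict {m : ℕ} (α : ℝ) (N : ℕ) (d : Fin m → ℝ) : ℝ :=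
  muHat α d + sigmaHat α d * expectedMax (gaussianReal 0 1) N

/-! Measurability of the prediction in the data. -/

lemma isClosed_empQuantile_set {m : ℕ} (p : ℝ) (d : Fin m → ℝ) :
    IsClosed {x : ℝ | p ≤ ((Finset.univ.filter fun j => d j ≤ x).card : ℝ) / m} := by
  have h : {x : ℝ | p ≤ ((Finset.univ.filter fun j => d j ≤ x).card : ℝ) / m} =
      ⋃ A ∈ {A : Finset (Fin m) | p ≤ (A.card : ℝ) / m}, {x : ℝ | ∀ j ∈ A, d j ≤ x} := by
    ext x
    simp only [Set.mem_ofPred_eq, Set.mem_iUnion, exists_prop]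
    constructor
    · intro hx
      exact ⟨_, hx, by simp⟩
    · rintro ⟨A, hA, hx⟩
      refine hA.trans ?_
      have : A.card ≤ (Finset.univ.filter fun j => d j ≤ x).card :=
        Finset.card_le_card fun j hj => by simpa using hx j hj
      gcongr
  rw [h]
  refine Set.Finite.isClosed_biUnion (Set.toFinite _) fun A _ => ?_
  simp only [Set.ofPred_forall]
  exact isClosed_iInter fun j => isClosed_iInter fun _ => isClosed_Ici

lemma measurable_count {m : ℕ} (x : ℝ) :
    Measurable fun d : Fin m → ℝ =>
      ((Finset.univ.filter fun j => d j ≤ x).card : ℝ) / m := by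
  refine Measurable.div_const ?_ _
  simp only [Finset.card_filter, Nat.cast_sum, Nat.cast_ite, Nat.cast_one, Nat.cast_zero]
  refine Finset.measurable_sum _ fun j _ => ?_
  exact Measurable.ite (measurableSet_le (measurable_pi_apply j) measurable_const)
    measurable_const measurable_const

lemma measurable_empQuantile {m : ℕ} (p : ℝ) :
    Measurable (empQuantile p : (Fin m → ℝ) → ℝ) := by
  rcases Nat.eq_zero_or_pos m with rfl | hm
  · exact Subsingleton.measurable
  have hm' : (0 : ℝ) < m := by exact_mod_cast hm
  by_cases hp0 : p ≤ 0
  · have : (empQuantile p : (Fin m → ℝ) → ℝ) = fun _ => 0 := by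
      funext d
      have : {x : ℝ | p ≤ ((Finset.univ.filter fun j => d j ≤ x).card : ℝ) / m} = Set.univ := by
        ext x
        simp only [Set.mem_ofPred_eq, Set.mem_univ, iff_true]
        exact hp0.trans (by positivity)
      rw [empQuantile, this, Real.sInf_univ]
    rw [this]
    exact measurable_const
  by_cases hp1 : 1 < p
  · have : (empQuantile p : (Fin m → ℝ) → ℝ) = fun _ => 0 := by
      funext d
      have : {x : ℝ | p ≤ ((Finset.univ.filter fun j => d j ≤ x).card : ℝ) / m} = ∅ := by
        ext x
        simp only [Set.mem_ofPred_eq, Set.mem_empty_iff_false, iff_false, not_le]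
        refine lt_of_le_of_lt ?_ hp1
        rw [div_le_one hm']
        have := Finset.card_filter_le (Finset.univ : Finset (Fin m)) fun j => d j ≤ x
        rw [Finset.card_univ, Fintype.card_fin] at this
        exact_mod_cast this
      rw [empQuantile, this, Real.sInf_empty]
    rw [this]
    exact measurable_const
  push Not at hp0 hp1
  have : Nonempty (Fin m) := ⟨⟨0, hm⟩⟩
  refine measurable_of_Iic fun x => ?_
  have key : empQuantile p ⁻¹' Set.Iic x =
      {d : Fin m → ℝ | p ≤ ((Finset.univ.filter fun j => d j ≤ x).card : ℝ) / m} := by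
    ext d
    simp only [Set.mem_preimage, Set.mem_Iic, Set.mem_ofPred_eq]
    have hne : {y : ℝ | p ≤ ((Finset.univ.filter fun j => d j ≤ y).card : ℝ) / m}.Nonempty := by
      refine ⟨Finset.univ.sup' Finset.univ_nonempty d, ?_⟩
      have : (Finset.univ.filter fun j => d j ≤ Finset.univ.sup' Finset.univ_nonempty d)
          = Finset.univ := by
        ext j
        simp only [Finset.mem_filter, Finset.mem_univ, true_and, iff_true]
        exact Finset.le_sup' d (Finset.mem_univ j)
      simp only [Set.mem_ofPred_eq, this, Finset.card_univ, Fintype.card_fin]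
      rwa [div_self hm'.ne']
    have hbdd : BddBelow
        {y : ℝ | p ≤ ((Finset.univ.filter fun j => d j ≤ y).card : ℝ) / m} := by
      refine ⟨Finset.univ.inf' Finset.univ_nonempty d, fun y hy => ?_⟩
      by_contra hlt
      push Not at hlt
      have : (Finset.univ.filter fun j => d j ≤ y) = ∅ := by
        ext j
        simp only [Finset.mem_filter, Finset.mem_univ, true_and, Finset.notMem_empty, iff_false,
          not_le]
        exact hlt.trans_le (Finset.inf'_le d (Finset.mem_univ j))
      simp only [Set.mem_ofPred_eq, this, Finset.card_empty, Nat.cast_zero, zero_div] at hy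
      exact absurd hy (not_le.mpr hp0)
    constructor
    · intro hx
      have hmem := (isClosed_empQuantile_set p d).csInf_mem hne hbdd
      refine le_trans (Set.mem_ofPred_eq ▸ hmem) ?_
      have : (Finset.univ.filter fun j => d j ≤ empQuantile p d).card ≤
          (Finset.univ.filter fun j => d j ≤ x).card :=
        Finset.card_le_card fun j hj => by
          simp only [Finset.mem_filter, Finset.mem_univ, true_and] at hj ⊢
          exact hj.trans hx
      have h2 : ((Finset.univ.filter fun j => d j ≤ empQuantile p d).card : ℝ) ≤
          ((Finset.univ.filter fun j => d j ≤ x).card : ℝ) := by exact_mod_cast this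
      exact div_le_div_of_nonneg_right h2 hm'.le
    · intro hx
      exact csInf_le hbdd hx
  rw [key]
  exact measurableSet_le measurable_const (measurable_count x)

lemma measurable_tail_sum {m : ℕ} (α : ℝ) (f : Fin m → (Fin m → ℝ) → ℝ)
    (hf : ∀ j, Measurable (f j)) :
    Measurable fun d : Fin m → ℝ => ∑ j ∈ tailSet α d, f j d := by
  simp only [tailSet, Finset.sum_filter]
  refine Finset.measurable_sum _ fun j _ => ?_
  exact Measurable.ite (measurableSet_le (measurable_empQuantile _) (measurable_pi_apply j))
    (hf j) measurable_const

lemma measurable_tail_card {m : ℕ} (α : ℝ) :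
    Measurable fun d : Fin m → ℝ => ((tailSet α d).card : ℝ) := by
  simpa using measurable_tail_sum (m := m) α (fun _ _ => 1) fun _ => measurable_const

lemma measurable_tailMean {m : ℕ} (α : ℝ) : Measurable (tailMean α : (Fin m → ℝ) → ℝ) :=
  (measurable_tail_sum α (fun j d => d j) fun j => measurable_pi_apply j).div
    (measurable_tail_card α)

lemma measurable_tailVar {m : ℕ} (α : ℝ) : Measurable (tailVar α : (Fin m → ℝ) → ℝ) :=
  (measurable_tail_sum α (fun j d => (d j - tailMean α d) ^ 2) fun j =>
    ((measurable_pi_apply j).sub (measurable_tailMean α)).pow_const 2).div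
    (measurable_tail_card α)

lemma measurable_sigmaHat {m : ℕ} (α : ℝ) : Measurable (sigmaHat α : (Fin m → ℝ) → ℝ) :=
  ((measurable_tailVar α).div_const _).sqrt

lemma measurable_predict {m : ℕ} (α : ℝ) (N : ℕ) :
    Measurable (predict α N : (Fin m → ℝ) → ℝ) :=
  ((measurable_tailMean α).sub ((measurable_sigmaHat α).mul_const _)).add
    ((measurable_sigmaHat α).mul_const _)

/-! ### Independent sampling as a kernel -/

/-- Given `a`, draw the coordinates independently, the `i`-th one from `κ i a`. -/
noncomputable def prodKernel {ι A B : Type*} [Fintype ι] [MeasurableSpace A] [MeasurableSpace B]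
    (κ : ι → Kernel A B) [∀ i, IsMarkovKernel (κ i)] : Kernel A (ι → B) where
  toFun a := Measure.pi fun i => κ i a
  measurable' := by
    refine Measurable.measure_of_isPiSystem_of_isProbabilityMeasure generateFrom_pi.symm
      isPiSystem_pi ?_
    rintro _ ⟨t, ht, rfl⟩
    simp only [Measure.pi_pi]
    exact Finset.measurable_prod _ fun i _ =>
      (κ i).measurable_coe (ht i (Set.mem_univ i))

instance prodKernel.isMarkov {ι A B : Type*} [Fintype ι] [MeasurableSpace A]
    [MeasurableSpace B] (κ : ι → Kernel A B) [∀ i, IsMarkovKernel (κ i)] :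
    IsMarkovKernel (prodKernel κ) :=
  ⟨fun a => inferInstanceAs (IsProbabilityMeasure (Measure.pi fun i => κ i a))⟩

/-! ### The two-stage generation model -/

/-- Two-stage generation from a fixed prompt: the law of the intermediate state generated from
the prompt, the law of the final response given the state, and the reward of a response. -/
structure Model (S : Type u) (Y : Type v) [MeasurableSpace S] [MeasurableSpace Y] where
  stateLaw : Measure S
  response : Kernel S Y
  reward : Y → ℝ
  isProb : IsProbabilityMeasure stateLaw
  isMarkov : IsMarkovKernel response
  measurable_reward : Measurable reward

attribute [instance] Model.isProb Model.isMarkov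

section Search

variable {S : Type u} {Y : Type v} [MeasurableSpace S] [MeasurableSpace Y]

/-- The reward distributions `F_s` of the states `s`: the law of the reward of a response that is
generated from `s`. -/
noncomputable def Model.rewardDist (M : Model S Y) : Kernel S ℝ :=
  M.response.map M.reward

instance Model.rewardDist.isMarkov (M : Model S Y) : IsMarkovKernel M.rewardDist :=
  Kernel.IsMarkovKernel.map _ M.measurable_reward

/-- The value `V_N(s)`: expected maximum of `N` i.i.d. rewards from `F_s`. -/
noncomputable def Model.value (M : Model S Y) (N : ℕ) (s : S) : ℝ :=
  expectedMax (M.rewardDist s) N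

/-- The Gaussian tail condition for the model with tail parameters `μ(s)`, `σ(s)`: it holds for
almost every generated state with the same `α` and `CR`, `σ(s) ∈ [σmin, σmax]` almost surely,
and `E[μ(s)²] ≤ Mμ`. -/
structure Model.UniformGaussianTail (M : Model S Y) (α σmin σmax CR Mμ : ℝ) (μ σ : S → ℝ) :
    Prop where
  tail : ∀ᵐ s ∂M.stateLaw, GaussianTail α CR (M.rewardDist s) (μ s) (σ s)
  sigma_mem : ∀ᵐ s ∂M.stateLaw, σ s ∈ Set.Icc σmin σmax
  integrable_mu_sq : Integrable (fun s => μ s ^ 2) M.stateLaw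
  mu_sq_le : ∫ s, μ s ^ 2 ∂M.stateLaw ≤ Mμ

/-! ### Algorithms -/

/-- `sel` picks an index of a largest entry of a vector (ties are broken in any measurable
way). -/
structure IsArgmax {K : ℕ} (sel : (Fin K → ℝ) → Fin K) : Prop where
  measurable : Measurable sel
  le_apply : ∀ (w : Fin K → ℝ) (i : Fin K), w i ≤ w (sel w)

lemma measurable_eval_index {K : ℕ} {A : Type*} [MeasurableSpace A] {f : A → Fin K → S}
    {g : A → Fin K} (hf : Measurable f) (hg : Measurable g) : Measurable fun a => f a (g a) := by
  have h : Measurable fun p : (Fin K → S) × Fin K => p.1 p.2 :=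
    measurable_from_prod_countable_left fun i => measurable_pi_apply i
  exact h.comp (hf.prodMk hg)

/-- The index chosen by SLG search: the largest prediction for budget `N` computed from the
rewards of the pilot responses `y i j`. -/
noncomputable def Model.slgIndex (M : Model S Y) (α : ℝ) (N : ℕ) {K m : ℕ}
    (sel : (Fin K → ℝ) → Fin K) (y : Fin K → Fin m → Y) : Fin K :=
  sel fun i => predict α N fun j => M.reward (y i j)

lemma Model.measurable_slgIndex (M : Model S Y) (α : ℝ) (N : ℕ) {K m : ℕ}
    {sel : (Fin K → ℝ) → Fin K} (hsel : IsArgmax sel) :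
    Measurable (M.slgIndex α N sel : (Fin K → Fin m → Y) → Fin K) := by
  refine hsel.measurable.comp (measurable_pi_lambda _ fun i => ?_)
  refine (measurable_predict α N).comp (measurable_pi_lambda _ fun j => ?_)
  exact M.measurable_reward.comp ((measurable_pi_apply j).comp (measurable_pi_apply i))

/-- First round of SLG search: given the states, `m` independent pilot responses from each. -/
noncomputable def Model.pilot (M : Model S Y) (K m : ℕ) :
    Kernel (Fin K → S) (Fin K → Fin m → Y) :=
  prodKernel fun i : Fin K => prodKernel fun _ : Fin m =>
    M.response.comap (fun s : Fin K → S => s i) (measurable_pi_apply i)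

instance Model.pilot.isMarkov (M : Model S Y) (K m : ℕ) : IsMarkovKernel (M.pilot K m) :=
  inferInstanceAs (IsMarkovKernel (prodKernel _))

/-- `n` independent responses from a given state. -/
noncomputable def Model.rollouts (M : Model S Y) (n : ℕ) : Kernel S (Fin n → Y) :=
  prodKernel fun _ : Fin n => M.response

instance Model.rollouts.isMarkov (M : Model S Y) (n : ℕ) : IsMarkovKernel (M.rollouts n) :=
  inferInstanceAs (IsMarkovKernel (prodKernel _))

/-- The law of a run of SLG search with total budget `N`, width `K` and `m` pilot samples per
state: `K` i.i.d. states, the pilot responses, and then `N - K * m` fresh responses from the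
state with the largest prediction. -/
noncomputable def Model.slgRun (M : Model S Y) (α : ℝ) (N K m : ℕ)
    {sel : (Fin K → ℝ) → Fin K} (hsel : IsArgmax sel) :
    Measure (((Fin K → S) × (Fin K → Fin m → Y)) × (Fin (N - K * m) → Y)) :=
  ((Measure.pi fun _ : Fin K => M.stateLaw) ⊗ₘ M.pilot K m) ⊗ₘ
    (M.rollouts (N - K * m)).comap (fun p => p.1 (M.slgIndex α N sel p.2))
      (measurable_eval_index measurable_fst ((M.measurable_slgIndex α N hsel).comp measurable_snd))

/-- The largest reward among all responses, pilot and final, generated in a run of SLG search. -/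
noncomputable def Model.slgBest (M : Model S Y) {K m n : ℕ}
    (ω : ((Fin K → S) × (Fin K → Fin m → Y)) × (Fin n → Y)) : ℝ :=
  sSup (M.reward '' (Set.range (fun p : Fin K × Fin m => ω.1.2 p.1 p.2) ∪ Set.range ω.2))

lemma Model.measurable_value (M : Model S Y) (N : ℕ) : Measurable (M.value N) := by
  have hf : Measurable fun x : Fin N → ℝ => ⨆ i, x i :=
    Measurable.iSup fun i => measurable_pi_apply i
  exact (hf.stronglyMeasurable.integral_kernel
    (κ := prodKernel fun _ : Fin N => M.rewardDist)).measurable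

/-- The index chosen by the full-information oracle: the largest true value `V_n(s_i)`. -/
noncomputable def Model.oracleIndex (M : Model S Y) {n : ℕ} (sel : (Fin n → ℝ) → Fin n)
    (s : Fin n → S) : Fin n :=
  sel fun i => M.value n (s i)

lemma Model.measurable_oracleIndex (M : Model S Y) {n : ℕ} {sel : (Fin n → ℝ) → Fin n}
    (hsel : IsArgmax sel) : Measurable (M.oracleIndex sel) :=
  hsel.measurable.comp (measurable_pi_lambda _ fun i =>
    (M.measurable_value n).comp (measurable_pi_apply i))

/-- The law of a run of the full-information oracle with budget `n`: `n` i.i.d. states, and then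
`n` responses from the state with the largest value `V_n`. -/
noncomputable def Model.oracleRun (M : Model S Y) (n : ℕ)
    {sel : (Fin n → ℝ) → Fin n} (hsel : IsArgmax sel) :
    Measure ((Fin n → S) × (Fin n → Y)) :=
  (Measure.pi fun _ : Fin n => M.stateLaw) ⊗ₘ
    (M.rollouts n).comap (fun s => s (M.oracleIndex sel s))
      (measurable_eval_index measurable_id (M.measurable_oracleIndex hsel))

/-- The largest reward among the responses generated in a run of the oracle. -/
noncomputable def Model.oracleBest (M : Model S Y) {n : ℕ} (ω : (Fin n → S) × (Fin n → Y)) : ℝ :=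
  sSup (M.reward '' Set.range ω.2)

end Search

end SLG

/-!
The proof compares, for fixed states `s_1, …, s_K`, the value of the state that SLG search selects
with the value of the state that the oracle selects; the theorem follows by integrating over the
states.

**Gaussian values.** Censoring at its `(1 - α)`-quantile `r` turns a reward law `F_s` into the
censored normal law with parameters `μ(s)`, `σ(s)` (`GaussianTail.map_max_eq`). Hence `V_n(s)`
differs from `μ(s) + σ(s) E(n)` only through the event that all `n` rewards are below `r`, whose
contribution is `O((1 - α)^(n - 1))` (`GaussianTail.abs_expectedMax_sub_le`).

**Accuracy of the predictions.** As long as the empirical `(1 - α / 2)`-quantile exceeds `r`, the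
prediction is a function of the censored data (`predict_eq_of_max_eq`), and it is equivariant under
affine maps (`predict_affine`), so that only standard normal samples have to be analysed. For
these, a few empirical tail moments at the fixed true quantile control the estimator
(`exists_estimator_accuracy`), and each of them obeys a Bernstein bound (`exists_concentration`).
With deviations of order `√(log N / m)` and `E(N) = O(√(log N))`, a prediction misses
`μ(s) + σ(s) E(N)` by more than `C log N / √m` with probability at most `12 / N ^ 3`
(`exists_predict_accuracy`). This is small enough for a union bound over the states combined with
the crude bound `|V_n(s)| ≤ n (1 + |CR|)` on the exceptional event.

**Budgets.** The selected state nearly maximizes `μ + σ E(N)`, but only about `N / 2` responses are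
drawn from it, and `E(N) - E(N / 2)` can be much larger than `log N / √m`. This loss matters only as
far as the standard deviations of the two states differ, and it is paid for by the surplus
`E(N / 2) - E(N / (2 Q))` that the oracle, with its budget of at most `N / (2 Q)`, gives away. To
compare the two differences without asymptotics of `E`, write `E(n + 1) - E(n)` as
`∫ Φ^n (1 - Φ)`. Since the normal hazard rate increases, `(n + 1) (E(n + 1) - E(n))` is
nonincreasing (`stdNormal_increment_antitone`), so that, with `g` the value of this quantity at
`N / 2`, the loss is at most `g` and the surplus at least `g log (2 Q / 3)`. A constant `Q`
depending on `σmax` and `σmin` suffices (`exists_value_comparison`).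
-/

namespace SLG

open Set Filter Topology

/-! ### The standard normal law -/

lemma stdNormal_pdf (x : ℝ) :
    gaussianPDFReal 0 1 x = (√(2 * Real.pi))⁻¹ * Real.exp (-x ^ 2 / 2) := by
  simp [gaussianPDFReal]

lemma stdNormal_pdf_pos (x : ℝ) : 0 < gaussianPDFReal 0 1 x :=
  gaussianPDFReal_pos 0 1 x one_ne_zero

lemma hasDerivAt_stdNormal_pdf (x : ℝ) :
    HasDerivAt (gaussianPDFReal 0 1) (-(x * gaussianPDFReal 0 1 x)) x := by
  have h : gaussianPDFReal 0 1 = fun x => (√(2 * Real.pi))⁻¹ * Real.exp (-x ^ 2 / 2) :=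
    funext stdNormal_pdf
  have h1 : HasDerivAt (fun x : ℝ => -x ^ 2 / 2) (-x) x := by
    exact (((hasDerivAt_pow 2 x).neg).div_const 2).congr_deriv (by push_cast; ring)
  rw [h]
  exact ((h1.exp).const_mul ((√(2 * Real.pi))⁻¹)).congr_deriv (by ring)

lemma continuous_stdNormal_pdf : Continuous (gaussianPDFReal 0 1) :=
  continuous_iff_continuousAt.2 fun x => (hasDerivAt_stdNormal_pdf x).continuousAt

lemma stdNormal_pdf_le (x : ℝ) : gaussianPDFReal 0 1 x ≤ 1 / 2 := by
  rw [stdNormal_pdf]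
  have h1 : Real.exp (-x ^ 2 / 2) ≤ 1 := Real.exp_le_one_iff.2 (by nlinarith [sq_nonneg x])
  have h2 : 2 ≤ √(2 * Real.pi) := Real.le_sqrt_of_sq_le (by nlinarith [Real.pi_gt_three])
  have h3 : (√(2 * Real.pi))⁻¹ ≤ 2⁻¹ := inv_anti₀ (by norm_num) h2
  calc _ ≤ (2⁻¹ : ℝ) * 1 := by gcongr
    _ = 1 / 2 := by norm_num

lemma setIntegral_stdNormal {s : Set ℝ} (hs : MeasurableSet s) (f : ℝ → ℝ) :
    ∫ x in s, f x ∂(gaussianReal 0 1) = ∫ x in s, gaussianPDFReal 0 1 x * f x := by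
  rw [← integral_indicator hs, ← integral_indicator hs,
    integral_gaussianReal_eq_integral_smul one_ne_zero]
  congr 1
  ext x
  by_cases hx : x ∈ s <;> simp [hx]

lemma integrableOn_stdNormal_iff {s : Set ℝ} (hs : MeasurableSet s) (f : ℝ → ℝ) :
    IntegrableOn f s (gaussianReal 0 1) ↔
      IntegrableOn (fun x => gaussianPDFReal 0 1 x * f x) s := by
  rw [IntegrableOn, gaussianReal_of_var_ne_zero _ one_ne_zero, restrict_withDensity hs,
    integrable_withDensity_iff_integrable_smul' (measurable_gaussianPDF 0 1)
      (by filter_upwards with x using gaussianPDF_lt_top)]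
  simp [IntegrableOn]

lemma stdNormal_integrable_pow (k : ℕ) : Integrable (fun x : ℝ => x ^ k) (gaussianReal 0 1) := by
  have := (memLp_id_gaussianReal (μ := 0) (v := 1) (k : NNReal)).integrable_norm_pow'
  simp only [id] at this
  exact this.mono' (by fun_prop) (by filter_upwards with x; simp)

lemma stdNormal_real_Iic (x : ℝ) : (gaussianReal 0 1).real (Iic x) = cdf (gaussianReal 0 1) x :=
  (cdf_eq_real _ x).symm

instance stdNormal_noAtoms : NullSingletonClass (gaussianReal 0 1) :=
  nullSingletonClass_gaussianReal one_ne_zero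

lemma stdNormal_real_Ioi (x : ℝ) :
    (gaussianReal 0 1).real (Ioi x) = 1 - cdf (gaussianReal 0 1) x := by
  rw [cdf_eq_real, ← compl_Iic, probReal_compl_eq_one_sub measurableSet_Iic]

lemma stdNormal_real_Ici (x : ℝ) :
    (gaussianReal 0 1).real (Ici x) = 1 - cdf (gaussianReal 0 1) x := by
  rw [← stdNormal_real_Ioi, measureReal_def, measureReal_def, measure_congr Ioi_ae_eq_Ici]

lemma stdNormal_real_Icc {a b : ℝ} (hab : a ≤ b) : (gaussianReal 0 1).real (Icc a b) =
    cdf (gaussianReal 0 1) b - cdf (gaussianReal 0 1) a := by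
  rw [measureReal_def, ← measure_congr (Ioc_ae_eq_Icc (a := a) (b := b)), ← measureReal_def,
    cdf_eq_real, cdf_eq_real, ← measureReal_sdiff (Iic_subset_Iic.2 hab) measurableSet_Iic,
    Iic_sdiff_Iic]

lemma stdNormal_cdf_sub (a b : ℝ) :
    cdf (gaussianReal 0 1) b - cdf (gaussianReal 0 1) a = ∫ x in a..b, gaussianPDFReal 0 1 x := by
  have h : ∀ y, cdf (gaussianReal 0 1) y = ∫ x in Iic y, gaussianPDFReal 0 1 x := fun y => by
    rw [cdf_eq_real]
    have := setIntegral_stdNormal (measurableSet_Iic (a := y)) (fun _ => 1)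
    simpa using this
  rw [h, h, intervalIntegral.integral_Iic_sub_Iic] <;>
  exact (integrable_gaussianPDFReal 0 1).integrableOn

lemma hasDerivAt_stdNormal_cdf (x : ℝ) :
    HasDerivAt (cdf (gaussianReal 0 1)) (gaussianPDFReal 0 1 x) x := by
  have h : (cdf (gaussianReal 0 1) : ℝ → ℝ) =
      fun y => cdf (gaussianReal 0 1) 0 + ∫ t in (0 : ℝ)..y, gaussianPDFReal 0 1 t := by
    ext y
    rw [← stdNormal_cdf_sub]
    ring
  rw [h]
  exact (continuous_stdNormal_pdf.integral_hasStrictDerivAt 0 x).hasDerivAt.const_add _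

lemma strictMono_stdNormal_cdf : StrictMono (cdf (gaussianReal 0 1)) :=
  strictMono_of_deriv_pos fun x => by
    rw [(hasDerivAt_stdNormal_cdf x).deriv]; exact stdNormal_pdf_pos x

lemma stdNormal_cdf_lt_one (x : ℝ) : cdf (gaussianReal 0 1) x < 1 :=
  (strictMono_stdNormal_cdf (lt_add_one x)).trans_le (cdf_le_one _ _)

lemma tendsto_pow_mul_stdNormal_pdf (k : ℕ) :
    Tendsto (fun x => x ^ k * gaussianPDFReal 0 1 x) atTop (𝓝 0) := by
  have h := (rpow_mul_exp_neg_mul_sq_isLittleO_exp_neg (b := 1 / 2) (by norm_num) k).trans_tendsto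
    (by
      have : Tendsto (fun x : ℝ => Real.exp (-(1 / 2) * x)) atTop (𝓝 0) :=
        Real.tendsto_exp_atBot.comp (tendsto_id.const_mul_atTop_of_neg (by norm_num))
      exact this)
  have h2 := h.const_mul ((√(2 * Real.pi))⁻¹)
  rw [mul_zero] at h2
  refine h2.congr fun x => ?_
  rw [stdNormal_pdf, Real.rpow_natCast]
  ring_nf

/-- First moment of the standard normal tail: `∫_a^∞ x φ(x) dx = φ(a)`. -/
lemma setIntegral_Ioi_id_stdNormal (a : ℝ) :
    ∫ x in Ioi a, x ∂(gaussianReal 0 1) = gaussianPDFReal 0 1 a := by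
  rw [setIntegral_stdNormal measurableSet_Ioi]
  have hint : IntegrableOn (fun x => gaussianPDFReal 0 1 x * x) (Ioi a) :=
    (integrableOn_stdNormal_iff measurableSet_Ioi (fun x => x)).1
      (by simpa using (stdNormal_integrable_pow 1).integrableOn)
  have := integral_Ioi_of_hasDerivAt_of_tendsto' (a := a)
    (f := fun x => -gaussianPDFReal 0 1 x) (f' := fun x => gaussianPDFReal 0 1 x * x)
    (m := 0) (fun x _ => (hasDerivAt_stdNormal_pdf x).neg.congr_deriv (by ring)) hint
    (by simpa using (tendsto_pow_mul_stdNormal_pdf 0).neg)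
  simpa using this

/-- Second moment of the standard normal tail: `∫_a^∞ x² φ(x) dx = a φ(a) + 1 - Φ(a)`. -/
lemma setIntegral_Ioi_sq_stdNormal (a : ℝ) :
    ∫ x in Ioi a, x ^ 2 ∂(gaussianReal 0 1) =
      a * gaussianPDFReal 0 1 a + (1 - cdf (gaussianReal 0 1) a) := by
  rw [setIntegral_stdNormal measurableSet_Ioi]
  have hint : IntegrableOn (fun x => gaussianPDFReal 0 1 x * x ^ 2) (Ioi a) :=
    (integrableOn_stdNormal_iff measurableSet_Ioi (fun x => x ^ 2)).1
      (stdNormal_integrable_pow 2).integrableOn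
  have := integral_Ioi_of_hasDerivAt_of_tendsto' (a := a)
    (f := fun x => cdf (gaussianReal 0 1) x - x * gaussianPDFReal 0 1 x)
    (f' := fun x => gaussianPDFReal 0 1 x * x ^ 2)
    (m := 1) (fun x _ => ((hasDerivAt_stdNormal_cdf x).sub
      ((hasDerivAt_id' x).mul (hasDerivAt_stdNormal_pdf x))).congr_deriv (by ring)) hint
    (by simpa using (tendsto_cdf_atTop _).sub (tendsto_pow_mul_stdNormal_pdf 1))
  rw [this]
  ring

/-- The mean of the normal tail above `a` is at least `a`. -/
lemma mul_one_sub_cdf_le_pdf (a : ℝ) :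
    a * (1 - cdf (gaussianReal 0 1) a) ≤ gaussianPDFReal 0 1 a := by
  rw [← setIntegral_Ioi_id_stdNormal, ← stdNormal_real_Ioi]
  have h : ∫ x in Ioi a, a ∂(gaussianReal 0 1) ≤ ∫ x in Ioi a, x ∂(gaussianReal 0 1) := by
    refine setIntegral_mono_on (integrable_const a).integrableOn ?_ measurableSet_Ioi ?_
    · simpa using (stdNormal_integrable_pow 1).integrableOn
    · exact fun x hx => (mem_Ioi.1 hx).le
  simpa [mul_comm] using h

/-- The Mills ratio of the standard normal law is nonincreasing, that is, the normal hazard rate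
is nondecreasing. -/
lemma antitone_stdNormal_millsRatio :
    Antitone fun x => (1 - cdf (gaussianReal 0 1) x) / gaussianPDFReal 0 1 x := by
  have hd : ∀ x, HasDerivAt (fun x => (1 - cdf (gaussianReal 0 1) x) / gaussianPDFReal 0 1 x)
      (((-gaussianPDFReal 0 1 x) * gaussianPDFReal 0 1 x -
        (1 - cdf (gaussianReal 0 1) x) * (-(x * gaussianPDFReal 0 1 x))) /
          gaussianPDFReal 0 1 x ^ 2) x := fun x =>
    ((hasDerivAt_stdNormal_cdf x).const_sub 1).div (hasDerivAt_stdNormal_pdf x)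
      (stdNormal_pdf_pos x).ne'
  refine antitone_of_deriv_nonpos (fun x => (hd x).differentiableAt) fun x => ?_
  rw [(hd x).deriv]
  refine div_nonpos_of_nonpos_of_nonneg ?_ (sq_nonneg _)
  nlinarith [mul_one_sub_cdf_le_pdf x, stdNormal_pdf_pos x]

/-! ### Quantiles -/

lemma le_cdf_quantile (F : Measure ℝ) {p : ℝ} (hp0 : 0 < p) (hp1 : p < 1) :
    p ≤ cdf F (quantile F p) ∧ ∀ x < quantile F p, cdf F x < p := by
  have hne : {x : ℝ | p ≤ cdf F x}.Nonempty := by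
    obtain ⟨x, hx⟩ := ((tendsto_cdf_atTop F).eventually (lt_mem_nhds hp1)).exists
    exact ⟨x, hx.le⟩
  have hbdd : BddBelow {x : ℝ | p ≤ cdf F x} := by
    obtain ⟨x, hx⟩ := ((tendsto_cdf_atBot F).eventually (gt_mem_nhds hp0)).exists
    refine ⟨x, fun y hy => ?_⟩
    by_contra hlt
    exact absurd (hy.trans (monotone_cdf F (not_le.1 hlt).le)) (not_le.2 hx)
  constructor
  · have hr : Tendsto (cdf F) (𝓝[>] (quantile F p)) (𝓝 (cdf F (quantile F p))) :=
      ((cdf F).right_continuous _).tendsto.mono_left (nhdsWithin_mono _ Ioi_subset_Ici_self)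
    refine ge_of_tendsto hr ?_
    filter_upwards [self_mem_nhdsWithin] with y hy
    obtain ⟨x, hx, hxy⟩ := (csInf_lt_iff hbdd hne).1 (mem_Ioi.1 hy)
    exact le_trans hx (monotone_cdf F hxy.le)
  · intro x hx
    by_contra hle
    exact absurd (csInf_le hbdd (not_lt.1 hle)) (not_le.2 hx)

lemma stdNormal_cdf_quantile {p : ℝ} (hp0 : 0 < p) (hp1 : p < 1) :
    cdf (gaussianReal 0 1) (quantile (gaussianReal 0 1) p) = p := by
  obtain ⟨h1, h2⟩ := le_cdf_quantile (gaussianReal 0 1) hp0 hp1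
  refine le_antisymm ?_ h1
  have hr : Tendsto (cdf (gaussianReal 0 1)) (𝓝[<] (quantile (gaussianReal 0 1) p))
      (𝓝 (cdf (gaussianReal 0 1) (quantile (gaussianReal 0 1) p))) :=
    (hasDerivAt_stdNormal_cdf _).continuousAt.tendsto.mono_left nhdsWithin_le_nhds
  refine le_of_tendsto hr ?_
  filter_upwards [self_mem_nhdsWithin] with y hy using (h2 y hy).le

/-- `truncVar z` is the variance of the standard normal law conditioned to be above `z`, which is
not a point mass. -/
lemma truncVar_pos (z : ℝ) : 0 < truncVar z := by
  set l := mills z with hl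
  have hq : 0 < 1 - cdf (gaussianReal 0 1) z := sub_pos.2 (stdNormal_cdf_lt_one z)
  have hl' : gaussianPDFReal 0 1 z = l * (1 - cdf (gaussianReal 0 1) z) := by
    rw [hl, mills, div_mul_cancel₀ _ hq.ne']
  have i1 : IntegrableOn (fun x : ℝ => x) (Ioi z) (gaussianReal 0 1) := by
    simpa using (stdNormal_integrable_pow 1).integrableOn
  have i2 : IntegrableOn (fun x : ℝ => x ^ 2) (Ioi z) (gaussianReal 0 1) :=
    (stdNormal_integrable_pow 2).integrableOn
  have i3 : IntegrableOn (fun x : ℝ => (x - l) ^ 2) (Ioi z) (gaussianReal 0 1) := by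
    have := (i2.sub (i1.const_mul (2 * l))).add
      (integrable_const (l ^ 2) : IntegrableOn (fun _ => l ^ 2) (Ioi z) (gaussianReal 0 1))
    refine this.congr ?_
    filter_upwards with x
    simp only [Pi.add_apply, Pi.sub_apply]
    ring
  have h : ∫ x in Ioi z, (x - l) ^ 2 ∂(gaussianReal 0 1) =
      (1 - cdf (gaussianReal 0 1) z) * truncVar z := by
    have e : ∀ x : ℝ, (x - l) ^ 2 = x ^ 2 - 2 * l * x + l ^ 2 := fun x => by ring
    have i4 : Integrable (fun x : ℝ => x ^ 2 - 2 * l * x)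
        ((gaussianReal 0 1).restrict (Ioi z)) := i2.sub (i1.const_mul (2 * l))
    simp_rw [e]
    rw [integral_add i4 (integrable_const _), integral_sub i2 (i1.const_mul (2 * l)),
      integral_const_mul, setIntegral_Ioi_id_stdNormal,
      setIntegral_Ioi_sq_stdNormal, setIntegral_const, stdNormal_real_Ioi, hl', truncVar, ← hl,
      smul_eq_mul]
    ring
  have hpos : 0 < ∫ x in Ioi z, (x - l) ^ 2 ∂(gaussianReal 0 1) := by
    rw [setIntegral_pos_iff_support_of_nonneg_ae (by filter_upwards with x using sq_nonneg _) i3]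
    have hsub : Ioi (max z l) ⊆ (Function.support fun x : ℝ => (x - l) ^ 2) ∩ Ioi z := by
      intro x hx
      have hx' := mem_Ioi.1 hx
      refine ⟨?_, (le_max_left _ _).trans_lt hx'⟩
      have : 0 < x - l := sub_pos.2 ((le_max_right _ _).trans_lt hx')
      exact (pow_pos this 2).ne'
    refine lt_of_lt_of_le ?_ (measure_mono hsub)
    have : 0 < (gaussianReal 0 1).real (Ioi (max z l)) := by
      rw [stdNormal_real_Ioi]; exact sub_pos.2 (stdNormal_cdf_lt_one _)
    exact (ENNReal.toReal_pos_iff.1 this).1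
  rw [h] at hpos
  exact (mul_pos_iff_of_pos_left hq).1 hpos

/-! ### Expected maxima -/

lemma abs_iSup_le_sum {n : ℕ} (x : Fin n → ℝ) : |⨆ i, x i| ≤ ∑ i, |x i| := by
  rcases Nat.eq_zero_or_pos n with rfl | hn
  · simp
  have : Nonempty (Fin n) := ⟨⟨0, hn⟩⟩
  obtain ⟨i, hi⟩ := exists_eq_ciSup_of_finite (f := x)
  rw [← hi]
  exact Finset.single_le_sum (f := fun i => |x i|) (fun _ _ => abs_nonneg _) (Finset.mem_univ i)

lemma measurable_iSup_fin (n : ℕ) : Measurable fun x : Fin n → ℝ => ⨆ i, x i :=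
  Measurable.iSup fun i => measurable_pi_apply i

lemma le_iSup_fin {n : ℕ} (x : Fin n → ℝ) (i : Fin n) : x i ≤ ⨆ i, x i :=
  le_ciSup (Finite.bddAbove_range x) i

lemma iSup_fin_succ {n : ℕ} (hn : n ≠ 0) (a : ℝ) (x : Fin n → ℝ) :
    ⨆ i, (Fin.cons a x : Fin (n + 1) → ℝ) i = max a (⨆ i, x i) := by
  have : Nonempty (Fin n) := ⟨⟨0, Nat.pos_of_ne_zero hn⟩⟩
  apply le_antisymm
  · refine ciSup_le fun i => ?_
    refine Fin.cases ?_ (fun j => ?_) i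
    · simp
    · simpa using Or.inr (le_iSup_fin x j)
  · refine max_le ?_ (ciSup_le fun j => ?_)
    · simpa using le_iSup_fin (Fin.cons a x : Fin (n + 1) → ℝ) 0
    · simpa using le_iSup_fin (Fin.cons a x : Fin (n + 1) → ℝ) j.succ

section Draws

variable {F : Measure ℝ} [IsProbabilityMeasure F]

lemma integrable_sum_abs_pi (hF : Integrable (fun x : ℝ => x) F) (n : ℕ) :
    Integrable (fun x : Fin n → ℝ => ∑ i, |x i|) (Measure.pi fun _ : Fin n => F) :=
  integrable_finsetSum _ fun i _ =>
    integrable_comp_eval (μ := fun _ : Fin n => F) (i := i) (f := fun x : ℝ => |x|) hF.abs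

lemma integrable_iSup_pi (hF : Integrable (fun x : ℝ => x) F) (n : ℕ) :
    Integrable (fun x : Fin n → ℝ => ⨆ i, x i) (Measure.pi fun _ : Fin n => F) :=
  (integrable_sum_abs_pi hF n).mono' (measurable_iSup_fin n).aestronglyMeasurable
    (by filter_upwards with x using abs_iSup_le_sum x)

lemma abs_expectedMax_le (hF : Integrable (fun x : ℝ => x) F) (n : ℕ) :
    |expectedMax F n| ≤ n * ∫ x, |x| ∂F := by
  calc |expectedMax F n| ≤ ∫ x : Fin n → ℝ, |⨆ i, x i| ∂(Measure.pi fun _ : Fin n => F) :=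
        abs_integral_le_integral_abs
    _ ≤ ∫ x : Fin n → ℝ, ∑ i, |x i| ∂(Measure.pi fun _ : Fin n => F) :=
        integral_mono (integrable_iSup_pi hF n).abs (integrable_sum_abs_pi hF n) abs_iSup_le_sum
    _ = n * ∫ x, |x| ∂F := by
        rw [integral_finsetSum _ fun i _ => integrable_comp_eval (μ := fun _ : Fin n => F)
          (i := i) (f := fun x : ℝ => |x|) hF.abs]
        simp_rw [integral_comp_eval (μ := fun _ : Fin n => F) (f := fun x : ℝ => |x|)
          hF.abs.aestronglyMeasurable]
        simp

/-- Isolating one of `n + 1` independent draws. -/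
lemma measurePreserving_cons (F : Measure ℝ) [IsProbabilityMeasure F] (n : ℕ) :
    MeasurePreserving (fun p : ℝ × (Fin n → ℝ) => (Fin.cons p.1 p.2 : Fin (n + 1) → ℝ))
      (F.prod (Measure.pi fun _ : Fin n => F)) (Measure.pi fun _ : Fin (n + 1) => F) := by
  have h := (measurePreserving_piFinSuccAbove (fun _ : Fin (n + 1) => F) 0).symm
  have e : ⇑(MeasurableEquiv.piFinSuccAbove (fun _ : Fin (n + 1) => ℝ) 0).symm =
      fun p : ℝ × (Fin n → ℝ) => (Fin.cons p.1 p.2 : Fin (n + 1) → ℝ) := by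
    ext p i
    refine Fin.cases ?_ (fun j => ?_) i <;> simp [MeasurableEquiv.piFinSuccAbove]
  rw [e] at h
  exact h

/-- One more draw raises the maximum by the positive part of its excess over the old maximum. -/
lemma integral_posPart_sub_iSup (hF : Integrable (fun x : ℝ => x) F) {n : ℕ} (hn : n ≠ 0) :
    Integrable (fun p : ℝ × (Fin n → ℝ) => max (p.1 - ⨆ i, p.2 i) 0)
        (F.prod (Measure.pi fun _ : Fin n => F)) ∧
      expectedMax F (n + 1) - expectedMax F n =
        ∫ p : ℝ × (Fin n → ℝ), max (p.1 - ⨆ i, p.2 i) 0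
          ∂(F.prod (Measure.pi fun _ : Fin n => F)) := by
  have i1 : Integrable (fun p : ℝ × (Fin n → ℝ) => p.1)
      (F.prod (Measure.pi fun _ : Fin n => F)) := hF.comp_fst _
  have i2 : Integrable (fun p : ℝ × (Fin n → ℝ) => ⨆ i, p.2 i)
      (F.prod (Measure.pi fun _ : Fin n => F)) := (integrable_iSup_pi hF n).comp_snd _
  have i3 : Integrable (fun p : ℝ × (Fin n → ℝ) => max (p.1 - ⨆ i, p.2 i) 0)
        (F.prod (Measure.pi fun _ : Fin n => F)) := (i1.sub i2).pos_part
  refine ⟨i3, ?_⟩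
  have h1 : expectedMax F (n + 1) = ∫ p : ℝ × (Fin n → ℝ), max p.1 (⨆ i, p.2 i)
      ∂(F.prod (Measure.pi fun _ : Fin n => F)) := by
    rw [expectedMax, ← (measurePreserving_cons F n).map_eq,
      integral_map (measurePreserving_cons F n).measurable.aemeasurable
        (measurable_iSup_fin _).aestronglyMeasurable]
    simp_rw [iSup_fin_succ hn]
  have h2 : expectedMax F n = ∫ p : ℝ × (Fin n → ℝ), (⨆ i, p.2 i)
      ∂(F.prod (Measure.pi fun _ : Fin n => F)) := by
    rw [integral_fun_snd (f := fun x : Fin n → ℝ => ⨆ i, x i)]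
    simp [expectedMax]
  have i4 : Integrable (fun p : ℝ × (Fin n → ℝ) => max p.1 (⨆ i, p.2 i))
      (F.prod (Measure.pi fun _ : Fin n => F)) := i1.sup i2
  rw [h1, h2, ← integral_sub i4 i2]
  congr 1
  ext p
  rw [← max_sub_sub_right, sub_self]

lemma expectedMax_mono (hF : Integrable (fun x : ℝ => x) F) {a b : ℕ} (ha : a ≠ 0) (hab : a ≤ b) :
    expectedMax F a ≤ expectedMax F b := by
  induction b, hab using Nat.le_induction with
  | base => exact le_rfl
  | succ b hab ih =>
    refine ih.trans (sub_nonneg.1 ?_)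
    rw [(integral_posPart_sub_iSup hF (by lia)).2]
    exact integral_nonneg fun _ => le_max_right _ _

lemma pi_iSup_le {n : ℕ} (hn : n ≠ 0) (x : ℝ) :
    (Measure.pi fun _ : Fin n => F) {y | ⨆ i, y i ≤ x} = F (Iic x) ^ n := by
  have : Nonempty (Fin n) := ⟨⟨0, Nat.pos_of_ne_zero hn⟩⟩
  have h : {y : Fin n → ℝ | ⨆ i, y i ≤ x} = univ.pi fun _ => Iic x := by
    ext y
    simp only [mem_ofPred_eq, Set.mem_pi, mem_univ, forall_const, mem_Iic]
    exact ⟨fun hy i => (le_iSup_fin y i).trans hy, fun hy => ciSup_le hy⟩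
  rw [h, Measure.pi_pi]
  simp

/-- The expected gain of one more draw, as an integral over the levels `x` that the new draw
exceeds and the old maximum does not. -/
lemma expectedMax_succ_sub (hF : Integrable (fun x : ℝ => x) F) {n : ℕ} (hn : n ≠ 0) :
    Integrable (fun x => cdf F x ^ n * (1 - cdf F x)) ∧
      expectedMax F (n + 1) - expectedMax F n = ∫ x, cdf F x ^ n * (1 - cdf F x) := by
  obtain ⟨hi, he⟩ := integral_posPart_sub_iSup hF hn
  set P := Measure.pi fun _ : Fin n => F with hP
  have hsup := measurable_iSup_fin n
  have hnn : ∀ x, 0 ≤ cdf F x ^ n * (1 - cdf F x) := fun x =>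
    mul_nonneg (pow_nonneg (cdf_nonneg _ _) _) (sub_nonneg.2 (cdf_le_one _ _))
  have hmeas : Measurable fun x => cdf F x ^ n * (1 - cdf F x) :=
    ((monotone_cdf F).measurable.pow_const n).mul
      (measurable_const.sub (monotone_cdf F).measurable)
  have hset : MeasurableSet {q : (ℝ × (Fin n → ℝ)) × ℝ | ⨆ i, q.1.2 i ≤ q.2 ∧ q.2 < q.1.1} :=
    (measurableSet_le (hsup.comp (measurable_snd.comp measurable_fst)) measurable_snd).inter
      (measurableSet_lt measurable_snd (measurable_fst.comp measurable_fst))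
  have key : ∫⁻ p : ℝ × (Fin n → ℝ), ENNReal.ofReal (max (p.1 - ⨆ i, p.2 i) 0) ∂(F.prod P) =
      ∫⁻ x, ENNReal.ofReal (cdf F x ^ n * (1 - cdf F x)) := by
    have h1 : ∀ p : ℝ × (Fin n → ℝ), ENNReal.ofReal (max (p.1 - ⨆ i, p.2 i) 0) =
        volume (Prod.mk p ⁻¹' {q : (ℝ × (Fin n → ℝ)) × ℝ | ⨆ i, q.1.2 i ≤ q.2 ∧ q.2 < q.1.1}) := by
      intro p
      have : (Prod.mk p ⁻¹' {q : (ℝ × (Fin n → ℝ)) × ℝ | ⨆ i, q.1.2 i ≤ q.2 ∧ q.2 < q.1.1}) =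
          Ico (⨆ i, p.2 i) p.1 := by ext; simp
      rw [this, Real.volume_Ico]
      rcases le_total (p.1 - ⨆ i, p.2 i) 0 with h | h
      · rw [max_eq_right h, ENNReal.ofReal_of_nonpos h, ENNReal.ofReal_zero]
      · rw [max_eq_left h]
    simp_rw [h1]
    rw [← Measure.prod_apply hset, Measure.prod_apply_symm hset]
    refine lintegral_congr fun x => ?_
    have : (fun p : ℝ × (Fin n → ℝ) => (p, x)) ⁻¹'
        {q : (ℝ × (Fin n → ℝ)) × ℝ | ⨆ i, q.1.2 i ≤ q.2 ∧ q.2 < q.1.1} =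
          Ioi x ×ˢ {y | ⨆ i, y i ≤ x} := by
      ext p
      simp [and_comm]
    rw [this, Measure.prod_prod, hP, pi_iSup_le hn,
      ENNReal.ofReal_mul (pow_nonneg (cdf_nonneg _ _) _), ENNReal.ofReal_pow (cdf_nonneg _ _),
      ofReal_cdf, mul_comm, cdf_eq_real,
      ← probReal_compl_eq_one_sub measurableSet_Iic, compl_Iic, measureReal_def,
      ENNReal.ofReal_toReal (measure_ne_top _ _)]
  have hfin : ∫⁻ x, ENNReal.ofReal (cdf F x ^ n * (1 - cdf F x)) < ⊤ := by
    rw [← key]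
    exact (hasFiniteIntegral_iff_ofReal (by filter_upwards with p using le_max_right _ _)).1 hi.2
  refine ⟨⟨hmeas.aestronglyMeasurable,
    (hasFiniteIntegral_iff_ofReal (by filter_upwards with p using hnn p)).2 hfin⟩, ?_⟩
  rw [he, integral_eq_lintegral_of_nonneg_ae (by filter_upwards with p using le_max_right _ _)
    hi.1, key, integral_eq_lintegral_of_nonneg_ae (by filter_upwards with p using hnn p)
    hmeas.aestronglyMeasurable]

end Draws

lemma integrable_id_stdNormal : Integrable (fun x : ℝ => x) (gaussianReal 0 1) := by
  simpa using stdNormal_integrable_pow 1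

/-- The rescaled increments `(n + 1) (E(n + 1) - E(n))` of the normal expected maxima decrease:
they are the mean reciprocal hazard rates at the maximum, and the normal hazard rate increases. -/
lemma stdNormal_increment_antitone {n : ℕ} (hn : n ≠ 0) :
    ((n + 1 : ℕ) + 1 : ℝ) * (expectedMax (gaussianReal 0 1) (n + 1 + 1) -
        expectedMax (gaussianReal 0 1) (n + 1)) ≤
      ((n : ℝ) + 1) * (expectedMax (gaussianReal 0 1) (n + 1) -
        expectedMax (gaussianReal 0 1) n) := by
  obtain ⟨i1, e1⟩ := expectedMax_succ_sub integrable_id_stdNormal hn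
  obtain ⟨i2, e2⟩ := expectedMax_succ_sub integrable_id_stdNormal (n := n + 1) (by lia)
  rw [e1, e2, ← sub_nonneg, ← integral_const_mul, ← integral_const_mul,
    ← integral_sub (i1.const_mul _) (i2.const_mul _)]
  set Φ := cdf (gaussianReal 0 1) with hΦ
  set φ := gaussianPDFReal 0 1 with hφ
  have hN : (0 : ℝ) < (n : ℝ) + 2 := by positivity
  -- the level at which the derivative of `u ^ (n + 1) - u ^ (n + 2)` changes sign
  set x₀ := quantile (gaussianReal 0 1) (((n : ℝ) + 1) / (n + 2)) with hx₀
  have hΦ₀ : Φ x₀ * (n + 2) = n + 1 := by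
    rw [hΦ, hx₀, stdNormal_cdf_quantile (by positivity) (by rw [div_lt_one hN]; linarith),
      div_mul_cancel₀ _ hN.ne']
  set w := fun x => (1 - Φ x) / φ x with hw
  have hwa : Antitone w := antitone_stdNormal_millsRatio
  have hder : ∀ x, HasDerivAt (fun x => Φ x ^ (n + 1) - Φ x ^ (n + 2))
      (φ x * (Φ x ^ n * ((n + 1) - (n + 2) * Φ x))) x := fun x => by
    refine (((hasDerivAt_stdNormal_cdf x).pow (n + 1)).sub
      ((hasDerivAt_stdNormal_cdf x).pow (n + 2))).congr_deriv ?_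
    simp only [Nat.add_sub_cancel, show n + 2 - 1 = n + 1 by lia]
    push_cast
    ring
  have hint : Integrable fun x => φ x * (Φ x ^ n * ((n + 1) - (n + 2) * Φ x)) := by
    refine (integrable_gaussianPDFReal 0 1).mul_bdd (c := (n : ℝ) + 1 + (n + 2)) ?_ ?_
    · exact (((monotone_cdf _).measurable.pow_const n).mul (measurable_const.sub
        (measurable_const.mul (monotone_cdf _).measurable))).aestronglyMeasurable
    · filter_upwards with x
      have h0 : 0 ≤ Φ x := cdf_nonneg _ _
      have h1 : Φ x ≤ 1 := cdf_le_one _ _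
      rw [Real.norm_eq_abs, abs_mul, abs_of_nonneg (pow_nonneg h0 n)]
      have h2 : |((n : ℝ) + 1) - (n + 2) * Φ x| ≤ n + 1 + (n + 2) := by
        rw [abs_le]
        constructor <;> nlinarith
      calc _ ≤ 1 * ((n : ℝ) + 1 + (n + 2)) :=
            mul_le_mul (pow_le_one₀ h0 h1) h2 (abs_nonneg _) zero_le_one
        _ = _ := one_mul _
  have hzero : ∫ x, φ x * (Φ x ^ n * ((n + 1) - (n + 2) * Φ x)) = 0 := by
    have hb := ((tendsto_cdf_atBot (gaussianReal 0 1)).pow (n + 1)).sub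
      ((tendsto_cdf_atBot (gaussianReal 0 1)).pow (n + 2))
    have ht := ((tendsto_cdf_atTop (gaussianReal 0 1)).pow (n + 1)).sub
      ((tendsto_cdf_atTop (gaussianReal 0 1)).pow (n + 2))
    rw [integral_of_hasDerivAt_of_tendsto hder hint hb ht]
    simp
  calc (0 : ℝ) = ∫ x, w x₀ * (φ x * (Φ x ^ n * ((n + 1) - (n + 2) * Φ x))) := by
        rw [integral_const_mul, hzero, mul_zero]
    _ ≤ _ := by
        refine integral_mono (hint.const_mul _) ((i1.const_mul _).sub (i2.const_mul _)) fun x => ?_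
        have hφx : 0 < φ x := stdNormal_pdf_pos x
        have h0 : 0 ≤ Φ x ^ n := pow_nonneg (cdf_nonneg _ _) _
        have hwx : 1 - Φ x = w x * φ x := by rw [hw]; exact (div_mul_cancel₀ _ hφx.ne').symm
        have hR : ((n : ℝ) + 1) * (Φ x ^ n * (1 - Φ x)) -
            ((n + 1 : ℕ) + 1 : ℝ) * (Φ x ^ (n + 1) * (1 - Φ x)) =
            φ x * Φ x ^ n * (w x * ((n + 1) - (n + 2) * Φ x)) := by
          rw [hwx]
          push_cast
          ring
        show w x₀ * (φ x * (Φ x ^ n * ((n + 1) - (n + 2) * Φ x))) ≤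
          ((n : ℝ) + 1) * (Φ x ^ n * (1 - Φ x)) -
            ((n + 1 : ℕ) + 1 : ℝ) * (Φ x ^ (n + 1) * (1 - Φ x))
        rw [hR]
        have hmain : w x₀ * ((n + 1) - (n + 2) * Φ x) ≤ w x * ((n + 1) - (n + 2) * Φ x) := by
          rcases le_total x x₀ with h | h
          · refine mul_le_mul_of_nonneg_right (hwa h) ?_
            have : Φ x ≤ Φ x₀ := monotone_cdf _ h
            nlinarith
          · refine mul_le_mul_of_nonpos_right (hwa h) ?_
            have : Φ x₀ ≤ Φ x := monotone_cdf _ h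
            nlinarith
        calc _ = φ x * Φ x ^ n * (w x₀ * ((n + 1) - (n + 2) * Φ x)) := by ring
          _ ≤ _ := mul_le_mul_of_nonneg_left hmain (mul_nonneg hφx.le h0)

/-- The rescaled increment `(n + 1) (E(n + 1) - E(n))` of the normal expected maxima `E`. -/
noncomputable def gain (n : ℕ) : ℝ :=
  ((n : ℝ) + 1) * (expectedMax (gaussianReal 0 1) (n + 1) - expectedMax (gaussianReal 0 1) n)

lemma gain_nonneg {n : ℕ} (hn : n ≠ 0) : 0 ≤ gain n :=
  mul_nonneg (by positivity)
    (sub_nonneg.2 (expectedMax_mono integrable_id_stdNormal hn (Nat.le_succ n)))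

lemma gain_antitone {a b : ℕ} (ha : a ≠ 0) (hab : a ≤ b) : gain b ≤ gain a := by
  induction b, hab using Nat.le_induction with
  | base => exact le_rfl
  | succ b hab ih => exact (stdNormal_increment_antitone (by lia)).trans ih

lemma expectedMax_succ_eq (n : ℕ) : expectedMax (gaussianReal 0 1) (n + 1) =
    expectedMax (gaussianReal 0 1) n + gain n / (n + 1) := by
  have : (n : ℝ) + 1 ≠ 0 := by positivity
  rw [gain]
  field_simp
  ring

/-- Summing `E(k + 1) - E(k) = gain k / (k + 1)` over `a ≤ k < b`, with `gain k ≥ gain b` and the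
harmonic sum bounded below by a logarithm. -/
lemma gain_mul_log_le {a b : ℕ} (ha : a ≠ 0) (hab : a ≤ b) :
    gain b * Real.log (((b : ℝ) + 1) / (a + 1)) ≤
      expectedMax (gaussianReal 0 1) b - expectedMax (gaussianReal 0 1) a := by
  induction b, hab using Nat.le_induction with
  | base => simp [div_self (show (a : ℝ) + 1 ≠ 0 by positivity)]
  | succ b hab ih =>
    have hb : (0 : ℝ) < b + 1 := by positivity
    have ha' : (0 : ℝ) < a + 1 := by positivity
    have hab' : (a : ℝ) ≤ b := by exact_mod_cast hab
    have hg := gain_antitone (a := b) (by lia) (Nat.le_succ b)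
    have hlog : Real.log ((((b + 1 : ℕ) : ℝ) + 1) / (a + 1)) ≤
        1 / (b + 1) + Real.log (((b : ℝ) + 1) / (a + 1)) := by
      have e : (((b + 1 : ℕ) : ℝ) + 1) / (a + 1) =
          ((b : ℝ) + 1 + 1) / (b + 1) * (((b : ℝ) + 1) / (a + 1)) := by
        push_cast
        field_simp
      rw [e, Real.log_mul (by positivity) (by positivity)]
      have := Real.log_le_sub_one_of_pos (show 0 < ((b : ℝ) + 1 + 1) / (b + 1) by positivity)
      have e2 : ((b : ℝ) + 1 + 1) / (b + 1) - 1 = 1 / (b + 1) := by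
        field_simp
        ring
      linarith
    have hl0 : 0 ≤ Real.log (((b : ℝ) + 1) / (a + 1)) :=
      Real.log_nonneg (by rw [one_le_div ha']; linarith)
    calc _ ≤ gain (b + 1) * (1 / (b + 1) + Real.log (((b : ℝ) + 1) / (a + 1))) :=
          mul_le_mul_of_nonneg_left hlog (gain_nonneg (by lia))
      _ ≤ gain b * (1 / (b + 1) + Real.log (((b : ℝ) + 1) / (a + 1))) :=
          mul_le_mul_of_nonneg_right hg (by positivity)
      _ ≤ _ := by
          rw [expectedMax_succ_eq]
          have : gain b * (1 / ((b : ℝ) + 1)) = gain b / (b + 1) := by ring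
          linarith

/-- At most doubling the number of draws adds at most the gain: each of the at most `a + 1` further
increments is at most `gain a / (a + 1)`. -/
lemma expectedMax_sub_le_gain {a b : ℕ} (ha : a ≠ 0) (hab : a ≤ b) (hb : b ≤ 2 * a + 1) :
    expectedMax (gaussianReal 0 1) b - expectedMax (gaussianReal 0 1) a ≤ gain a := by
  have h : expectedMax (gaussianReal 0 1) b - expectedMax (gaussianReal 0 1) a ≤
      gain a * (((b : ℝ) - a) / (a + 1)) := by
    clear hb
    induction b, hab using Nat.le_induction with
    | base => simp
    | succ b hab ih =>
      rw [expectedMax_succ_eq]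
      have h1 : gain b / ((b : ℝ) + 1) ≤ gain a / (a + 1) :=
        div_le_div₀ (gain_nonneg ha) (gain_antitone ha hab) (by positivity)
          (by have : (a : ℝ) ≤ b := by exact_mod_cast hab
              linarith)
      have h2 : gain a * ((((b + 1 : ℕ) : ℝ) - a) / (a + 1)) =
          gain a * (((b : ℝ) - a) / (a + 1)) + gain a / (a + 1) := by
        push_cast
        ring
      linarith
  refine h.trans (mul_le_of_le_one_right (gain_nonneg ha) ?_)
  rw [div_le_one (by positivity)]
  have : (b : ℝ) ≤ 2 * a + 1 := by exact_mod_cast hb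
  linarith

lemma expectedMax_stdNormal_nonneg (n : ℕ) : 0 ≤ expectedMax (gaussianReal 0 1) n := by
  rcases Nat.eq_zero_or_pos n with rfl | hn
  · simp [expectedMax]
  have h1 : expectedMax (gaussianReal 0 1) 1 = 0 := by
    have := integral_comp_eval (μ := fun _ : Fin 1 => gaussianReal 0 1) (i := 0)
      (f := fun x : ℝ => x) integrable_id_stdNormal.aestronglyMeasurable
    rw [integral_id_gaussianReal] at this
    simpa [expectedMax] using this
  exact h1.symm.le.trans (expectedMax_mono integrable_id_stdNormal one_ne_zero hn)

/-- The expected maximum of `n` standard normal variables is at most of order `√(log n)`. -/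
lemma expectedMax_stdNormal_le {n : ℕ} (hn : 2 ≤ n) :
    expectedMax (gaussianReal 0 1) n ≤ 2 * √(2 * Real.log n) := by
  set a := √(2 * Real.log n) with ha
  have hlog : Real.log 2 ≤ Real.log n := Real.log_le_log (by norm_num) (by exact_mod_cast hn)
  have hl2 := Real.log_two_gt_d9
  have ha1 : 1 ≤ a := Real.one_le_sqrt.2 (by linarith)
  have hasq : a ^ 2 = 2 * Real.log n := Real.sq_sqrt (by linarith)
  have hn0 : (0 : ℝ) < n := by positivity
  have : Nonempty (Fin n) := ⟨⟨0, by lia⟩⟩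
  have hexp : Integrable (fun x : ℝ => Real.exp (a * x)) (gaussianReal 0 1) :=
    integrable_exp_mul_gaussianReal a
  have hmgf : ∫ x, Real.exp (a * x) ∂(gaussianReal 0 1) = Real.exp (a ^ 2 / 2) := by
    have := congrFun (mgf_id_gaussianReal (μ := 0) (v := 1)) a
    simpa [mgf] using this
  have hi : ∀ i : Fin n, Integrable (fun x : Fin n → ℝ => Real.exp (-a ^ 2) / a *
      Real.exp (a * x i)) (Measure.pi fun _ : Fin n => gaussianReal 0 1) := fun i =>
    (integrable_comp_eval (μ := fun _ : Fin n => gaussianReal 0 1) (i := i) hexp).const_mul _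
  -- linear functions are dominated by exponentials: `y ≤ exp (a y) / a` with `y = x i - a`
  have hpt : ∀ x : Fin n → ℝ, ⨆ i, x i ≤ a + ∑ i, Real.exp (-a ^ 2) / a * Real.exp (a * x i) := by
    intro x
    refine ciSup_le fun i => ?_
    have h1 : x i - a ≤ Real.exp (-a ^ 2) / a * Real.exp (a * x i) := by
      have := Real.add_one_le_exp (a * (x i - a))
      rw [div_mul_eq_mul_div, ← Real.exp_add, le_div_iff₀ (by linarith)]
      have e : -a ^ 2 + a * x i = a * (x i - a) := by ring
      rw [e]
      linarith
    have h2 := Finset.single_le_sum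
      (f := fun i => Real.exp (-a ^ 2) / a * Real.exp (a * x i))
      (fun _ _ => by positivity) (Finset.mem_univ i)
    exact (by linarith : x i ≤ a + Real.exp (-a ^ 2) / a * Real.exp (a * x i)).trans
      (add_le_add_right h2 a)
  calc expectedMax (gaussianReal 0 1) n
      ≤ ∫ x : Fin n → ℝ, (a + ∑ i, Real.exp (-a ^ 2) / a * Real.exp (a * x i))
          ∂(Measure.pi fun _ : Fin n => gaussianReal 0 1) :=
        integral_mono (integrable_iSup_pi integrable_id_stdNormal n)
          ((integrable_const a).add (integrable_finsetSum _ fun i _ => hi i)) hpt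
    _ = a + n * (Real.exp (-a ^ 2) / a * Real.exp (a ^ 2 / 2)) := by
        rw [integral_add (integrable_const a) (integrable_finsetSum _ fun i _ => hi i),
          integral_finsetSum _ fun i _ => hi i]
        simp_rw [integral_const_mul]
        have (i : Fin n) := integral_comp_eval (μ := fun _ : Fin n => gaussianReal 0 1) (i := i)
          (f := fun x : ℝ => Real.exp (a * x)) hexp.aestronglyMeasurable
        simp_rw [this, hmgf]
        simp
    _ = a + 1 / a := by
        congr 1
        have e : Real.exp (-a ^ 2) / a * Real.exp (a ^ 2 / 2) = Real.exp (-Real.log n) / a := by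
          rw [div_mul_eq_mul_div, ← Real.exp_add, hasq]
          ring_nf
        rw [e, Real.exp_neg, Real.exp_log hn0]
        field_simp
    _ ≤ 2 * a := by
        have : 1 / a ≤ 1 := by rw [div_le_one (by linarith)]; exact ha1
        linarith

/-! ### Reward laws with a Gaussian tail -/

section Censoring

variable {F : Measure ℝ} [IsProbabilityMeasure F]

lemma map_iSup_fin {f : ℝ → ℝ} (hf : Monotone f) {n : ℕ} (hn : n ≠ 0) (x : Fin n → ℝ) :
    ⨆ i, f (x i) = f (⨆ i, x i) := by
  have : Nonempty (Fin n) := ⟨⟨0, Nat.pos_of_ne_zero hn⟩⟩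
  apply le_antisymm
  · exact ciSup_le fun i => hf (le_iSup_fin x i)
  · obtain ⟨i, hi⟩ := exists_eq_ciSup_of_finite (f := x)
    rw [← hi]
    exact le_iSup_fin (fun i => f (x i)) i

lemma pi_map_comp {A : Type*} [MeasurableSpace A] (P : Measure A) [IsProbabilityMeasure P]
    {f : A → ℝ} (hf : Measurable f) (n : ℕ) :
    (Measure.pi fun _ : Fin n => P.map f) =
      (Measure.pi fun _ : Fin n => P).map (fun x i => f (x i)) := by
  have : IsProbabilityMeasure (P.map f) := Measure.isProbabilityMeasure_map hf.aemeasurable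
  exact (Measure.pi_map_pi (μ := fun _ : Fin n => P) (f := fun _ => f)
    fun _ => hf.aemeasurable).symm

lemma expectedMax_map {f : ℝ → ℝ} (hf : Monotone f) {n : ℕ} (hn : n ≠ 0) :
    expectedMax (F.map f) n = ∫ x : Fin n → ℝ, f (⨆ i, x i) ∂(Measure.pi fun _ : Fin n => F) := by
  have hm : Measurable fun (x : Fin n → ℝ) i => f (x i) :=
    measurable_pi_lambda _ fun i => hf.measurable.comp (measurable_pi_apply i)
  rw [expectedMax, pi_map_comp F hf.measurable, integral_map hm.aemeasurable
    (measurable_iSup_fin n).aestronglyMeasurable]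
  simp_rw [map_iSup_fin hf hn]

/-- The expected shortfall of the maximum of `n + 1` draws below `r` decays geometrically in `n`,
since all draws have to be below `r`. -/
lemma integral_shortfall_le (hF : Integrable (fun x : ℝ => x) F) (r : ℝ) (n : ℕ) :
    ∫ x : Fin (n + 1) → ℝ, max (r - ⨆ i, x i) 0 ∂(Measure.pi fun _ : Fin (n + 1) => F) ≤
      (∫ x, max (r - x) 0 ∂F) * F.real (Iio r) ^ n := by
  set f : Fin (n + 1) → ℝ → ℝ :=
    fun i => Fin.cases (fun x => max (r - x) 0) (fun _ => (Iio r).indicator 1) i with hf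
  have hi : ∀ i, Integrable (f i) F := fun i => by
    refine Fin.cases ?_ (fun j => ?_) i
    · exact ((integrable_const r).sub hF).pos_part
    · exact (integrable_const (1 : ℝ)).indicator measurableSet_Iio
  have h := integral_fintype_prod_eq_prod (μ := fun _ : Fin (n + 1) => F) f
  have h2 : ∏ i, ∫ x, f i x ∂F = (∫ x, max (r - x) 0 ∂F) * F.real (Iio r) ^ n := by
    rw [Fin.prod_univ_succ]
    simp [hf, integral_indicator_one measurableSet_Iio]
  rw [← h2, ← h]
  refine integral_mono
    (((integrable_const r).sub (integrable_iSup_pi hF (n + 1))).pos_part)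
    (Integrable.fintype_prod hi) fun x => ?_
  have hnn : ∀ i, 0 ≤ f i (x i) := fun i => by
    refine Fin.cases ?_ (fun j => ?_) i
    · exact le_max_right _ _
    · exact indicator_nonneg (fun _ _ => zero_le_one) _
  refine max_le ?_ (Finset.prod_nonneg fun i _ => hnn i)
  by_cases hx : ∀ i, x i < r
  · have : ∏ i, f i (x i) = max (r - x 0) 0 := by
      rw [Fin.prod_univ_succ]
      simp [hf, hx]
    rw [this]
    exact (sub_le_sub_left (le_iSup_fin x 0) r).trans (le_max_left _ _)
  · push Not at hx
    obtain ⟨i, hi⟩ := hx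
    have h1 : r - ⨆ i, x i ≤ 0 := sub_nonpos.2 (hi.trans (le_iSup_fin x i))
    exact h1.trans (Finset.prod_nonneg fun i _ => hnn i)

/-- The expected maximum is that of the draws censored at `r`, less the expected shortfall of the
maximum below `r`. -/
lemma expectedMax_eq_censored_sub (hF : Integrable (fun x : ℝ => x) F) (r : ℝ) {n : ℕ}
    (hn : n ≠ 0) : expectedMax F n = expectedMax (F.map fun x => max x r) n -
      ∫ x : Fin n → ℝ, max (r - ⨆ i, x i) 0 ∂(Measure.pi fun _ : Fin n => F) := by
  have hmono : Monotone fun x : ℝ => max x r := fun a b h => max_le_max_right r h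
  have hi := integrable_iSup_pi hF n
  have h1 : Integrable (fun x : Fin n → ℝ => max (⨆ i, x i) r) (Measure.pi fun _ : Fin n => F) :=
    hi.sup (integrable_const r)
  have h2 : Integrable (fun x : Fin n → ℝ => max (r - ⨆ i, x i) 0)
      (Measure.pi fun _ : Fin n => F) := ((integrable_const r).sub hi).pos_part
  rw [expectedMax_map hmono hn, expectedMax, ← integral_sub h1 h2]
  congr 1
  ext x
  rcases le_total (⨆ i, x i) r with h | h
  · rw [max_eq_right h, max_eq_left (sub_nonneg.2 h)]
    ring
  · rw [max_eq_left h, max_eq_right (sub_nonpos.2 h)]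
    ring

end Censoring

/-- Two laws that agree on `[r, ∞)` have the same image under censoring at `r`. -/
lemma map_max_eq_of_restrict_Ici_eq {F G : Measure ℝ} [IsProbabilityMeasure F]
    [IsProbabilityMeasure G] {r : ℝ} (h : F.restrict (Ici r) = G.restrict (Ici r)) :
    F.map (fun x => max x r) = G.map (fun x => max x r) := by
  have hm : Measurable fun x : ℝ => max x r := measurable_id.max measurable_const
  have hA : ∀ A, MeasurableSet A → F (A ∩ Ici r) = G (A ∩ Ici r) := fun A hA => by
    rw [← Measure.restrict_apply hA, h, Measure.restrict_apply hA]
  have hlow : F (Iio r) = G (Iio r) := by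
    have h1 : F (Ici r) = G (Ici r) := by simpa using hA univ MeasurableSet.univ
    rw [← compl_Ici, prob_compl_eq_one_sub measurableSet_Ici, h1,
      prob_compl_eq_one_sub measurableSet_Ici]
  ext s hs
  rw [Measure.map_apply hm hs, Measure.map_apply hm hs]
  set A := (fun x : ℝ => max x r) ⁻¹' s with hAdef
  have hAm : MeasurableSet A := hm hs
  rw [← measure_inter_add_sdiff A measurableSet_Ici (μ := F) (t := Ici r),
    ← measure_inter_add_sdiff A measurableSet_Ici (μ := G) (t := Ici r), hA A hAm]
  congr 1
  by_cases hr : r ∈ s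
  · have : A \ Ici r = Iio r := by
      ext x
      simp only [hAdef, Set.mem_sdiff, mem_preimage, mem_Ici, not_le, mem_Iio,
        and_iff_right_iff_imp]
      intro hx
      rwa [max_eq_right hx.le]
    rw [this, hlow]
  · have : A \ Ici r = ∅ := by
      ext x
      simp only [hAdef, Set.mem_sdiff, mem_preimage, mem_Ici, not_le, mem_empty_iff_false,
        iff_false, not_and, not_lt]
      intro hx
      by_contra hlt
      rw [max_eq_right (not_le.1 hlt).le] at hx
      exact hr hx
    rw [this]
    simp

lemma gaussianReal_eq_map_stdNormal (μ σ : ℝ) :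
    gaussianReal μ (Real.toNNReal (σ ^ 2)) = (gaussianReal 0 1).map (fun x => μ + σ * x) := by
  have h1 := gaussianReal_map_const_mul (μ := 0) (v := 1) σ
  have h2 : (gaussianReal 0 1).map (fun x => μ + σ * x) =
      ((gaussianReal 0 1).map (fun x => σ * x)).map (fun x => μ + x) := by
    rw [Measure.map_map (by fun_prop) (by fun_prop)]
    rfl
  rw [h2, h1, gaussianReal_map_const_add]
  congr 1
  · simp
  · ext
    simp [sq_nonneg]

namespace GaussianTail

variable {α CR : ℝ} {F : Measure ℝ} {μ σ : ℝ}

lemma CR_nonneg (h : GaussianTail α CR F μ σ) : 0 ≤ CR :=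
  (integral_nonneg fun x => sq_nonneg x).trans h.second_moment_le

lemma restrict_eq (h : GaussianTail α CR F μ σ) (hσ : 0 < σ) :
    F.restrict (Ici (quantile F (1 - α))) =
      (gaussianReal μ (Real.toNNReal (σ ^ 2))).restrict (Ici (quantile F (1 - α))) := by
  rw [h.tail, gaussianReal_of_var_ne_zero]
  simpa using hσ.ne'

variable [IsProbabilityMeasure F]

lemma integrable_id (h : GaussianTail α CR F μ σ) : Integrable (fun x : ℝ => x) F := by
  refine ((integrable_const (1 : ℝ)).add h.integrable_sq).mono'
    measurable_id.aestronglyMeasurable ?_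
  filter_upwards with x
  simp only [Real.norm_eq_abs, Pi.add_apply]
  nlinarith [sq_abs x, sq_nonneg (|x| - 1)]

lemma integral_abs_le (h : GaussianTail α CR F μ σ) : ∫ x, |x| ∂F ≤ 1 + CR := by
  calc ∫ x, |x| ∂F ≤ ∫ x, (1 + x ^ 2) ∂F := by
        refine integral_mono h.integrable_id.abs ((integrable_const _).add h.integrable_sq) ?_
        intro x
        simp only
        nlinarith [sq_abs x, sq_nonneg (|x| - 1)]
    _ = 1 + ∫ x, x ^ 2 ∂F := by
        rw [integral_add (integrable_const _) h.integrable_sq]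
        simp
    _ ≤ 1 + CR := by linarith [h.second_moment_le]

/-- The mass below the quantile is exactly `1 - α`, because the density leaves no atom there. -/
lemma real_Iio_quantile (h : GaussianTail α CR F μ σ) (hσ : 0 < σ) (hα0 : 0 < α) (hα1 : α < 1) :
    F.real (Iio (quantile F (1 - α))) = 1 - α := by
  obtain ⟨h1, h2⟩ := le_cdf_quantile F (p := 1 - α) (by linarith) (by linarith)
  set r := quantile F (1 - α) with hr
  have : NullSingletonClass (gaussianReal μ (Real.toNNReal (σ ^ 2))) :=
    nullSingletonClass_gaussianReal (by simpa using hσ.ne')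
  have hatom : F {r} = 0 := by
    have e : F.restrict (Ici r) {r} = 0 := by
      rw [h.restrict_eq hσ]
      exact le_antisymm ((Measure.restrict_apply_le _ _).trans (measure_singleton r).le) bot_le
    rwa [Measure.restrict_apply (measurableSet_singleton r),
      inter_eq_left.2 (singleton_subset_iff.2 self_mem_Ici)] at e
  refine le_antisymm ?_ ?_
  · have h3 := (cdf F).measure_Iio (tendsto_cdf_atBot F) r
    rw [measure_cdf, sub_zero] at h3
    have h4 : Function.leftLim (cdf F) r ≤ 1 - α :=
      le_of_tendsto ((monotone_cdf F).tendsto_leftLim r) (by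
        filter_upwards [self_mem_nhdsWithin] with x hx using (h2 x hx).le)
    rw [measureReal_def, h3]
    exact ENNReal.toReal_le_of_le_ofReal (by linarith) (ENNReal.ofReal_le_ofReal h4)
  · rw [cdf_eq_real] at h1
    refine h1.trans (ENNReal.toReal_mono (measure_ne_top _ _) ?_)
    rw [← Iio_union_right]
    refine (measure_union_le _ _).trans ?_
    rw [hatom, add_zero]

/-- The `(1 - α)`-quantile is that of the Gaussian law with the same tail. -/
lemma quantile_eq (h : GaussianTail α CR F μ σ) (hσ : 0 < σ) (hα0 : 0 < α) (hα1 : α < 1) :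
    quantile F (1 - α) = μ + σ * quantile (gaussianReal 0 1) (1 - α) := by
  set r := quantile F (1 - α) with hr
  have h1 : (gaussianReal μ (Real.toNNReal (σ ^ 2))).real (Ici r) = α := by
    have e : F.real (Ici r) = α := by
      rw [← compl_Iio, probReal_compl_eq_one_sub measurableSet_Iio,
        h.real_Iio_quantile hσ hα0 hα1]
      ring
    have e2 := congrArg (fun P : Measure ℝ => (P univ).toReal) (h.restrict_eq hσ)
    simp only [Measure.restrict_apply_univ] at e2
    rw [measureReal_def, ← e2, ← measureReal_def, e]
  rw [gaussianReal_eq_map_stdNormal, map_measureReal_apply (by fun_prop) measurableSet_Ici] at h1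
  have h2 : (fun x => μ + σ * x) ⁻¹' Ici r = Ici ((r - μ) / σ) := by
    ext x
    simp only [mem_preimage, mem_Ici]
    rw [div_le_iff₀ hσ]
    constructor <;> intro <;> linarith
  rw [h2, stdNormal_real_Ici] at h1
  have h3 : (r - μ) / σ = quantile (gaussianReal 0 1) (1 - α) :=
    strictMono_stdNormal_cdf.injective (by
      rw [stdNormal_cdf_quantile (by linarith) (by linarith)]
      linarith)
  rw [← h3]
  field_simp
  ring

/-- The law `F` and the Gaussian law with its tail parameters agree after censoring at the
`(1 - α)`-quantile. -/
lemma map_max_eq (h : GaussianTail α CR F μ σ) (hσ : 0 < σ) :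
    F.map (fun x => max x (quantile F (1 - α))) =
      (gaussianReal 0 1).map (fun x => max (μ + σ * x) (quantile F (1 - α))) := by
  rw [map_max_eq_of_restrict_Ici_eq (h.restrict_eq hσ), gaussianReal_eq_map_stdNormal,
    Measure.map_map (by fun_prop) (by fun_prop)]
  rfl

/-- The quantile is bounded above through Markov's inequality: a mass `α` sits above it, and the
second moment is at most `CR`. -/
lemma quantile_le (h : GaussianTail α CR F μ σ) (hσ : 0 < σ) (hα0 : 0 < α) (hα1 : α < 1) :
    max (quantile F (1 - α)) 0 ≤ 1 + CR / α := by
  set r := quantile F (1 - α) with hr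
  have hCR := h.CR_nonneg
  refine max_le ?_ (by positivity)
  by_contra hlt
  have hr1 : 1 + CR / α < r := not_le.1 hlt
  have hr0 : 0 < r := lt_trans (by positivity) hr1
  have e : F.real (Ici r) = α := by
    rw [← compl_Iio, probReal_compl_eq_one_sub measurableSet_Iio,
      h.real_Iio_quantile hσ hα0 hα1]
    ring
  have h1 : r ^ 2 * α ≤ CR := by
    calc r ^ 2 * α = ∫ x in Ici r, r ^ 2 ∂F := by
          rw [setIntegral_const, e, smul_eq_mul, mul_comm]
      _ ≤ ∫ x in Ici r, x ^ 2 ∂F := by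
          refine setIntegral_mono_on (integrable_const _).integrableOn
            h.integrable_sq.integrableOn measurableSet_Ici fun x hx => ?_
          exact pow_le_pow_left₀ hr0.le (mem_Ici.1 hx) 2
      _ ≤ ∫ x, x ^ 2 ∂F := setIntegral_le_integral h.integrable_sq
          (by filter_upwards with x using sq_nonneg x)
      _ ≤ CR := h.second_moment_le
  have h2 : r ^ 2 ≤ CR / α := by rw [le_div_iff₀ hα0]; exact h1
  nlinarith [sq_nonneg (r - 1)]

/-- The value of a law with a Gaussian tail is that of the Gaussian law `μ + σ E(n)`, up to an
error that is exponentially small in `n`. -/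
lemma abs_expectedMax_sub_le (h : GaussianTail α CR F μ σ) (hσ : 0 < σ) (hα0 : 0 < α)
    (hα1 : α < 1) {n : ℕ} (hn : n ≠ 0) :
    |expectedMax F n - (μ + σ * expectedMax (gaussianReal 0 1) n)| ≤
      (σ * (|quantile (gaussianReal 0 1) (1 - α)| + ∫ x, |x| ∂(gaussianReal 0 1)) +
        (2 + CR / α + CR)) * (1 - α) ^ (n - 1) := by
  obtain ⟨k, rfl⟩ := Nat.exists_eq_succ_of_ne_zero hn
  simp only [Nat.succ_eq_add_one, Nat.add_sub_cancel]
  set r := quantile F (1 - α) with hr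
  set z := quantile (gaussianReal 0 1) (1 - α) with hz
  have hrz : r = μ + σ * z := h.quantile_eq hσ hα0 hα1
  set G := gaussianReal μ (Real.toNNReal (σ ^ 2)) with hG
  have hGm : G = (gaussianReal 0 1).map (fun x => μ + σ * x) := gaussianReal_eq_map_stdNormal μ σ
  have haff : Monotone fun x : ℝ => μ + σ * x := fun a b hab => by
    have := mul_le_mul_of_nonneg_left hab hσ.le
    simp only
    linarith
  have haffm : AEMeasurable (fun x : ℝ => μ + σ * x) (gaussianReal 0 1) := by fun_prop
  have hGi : Integrable (fun x : ℝ => x) G := by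
    rw [hGm]
    refine (integrable_map_measure measurable_id.aestronglyMeasurable haffm).2 ?_
    exact (integrable_const μ).add (integrable_id_stdNormal.const_mul σ)
  have hGE : expectedMax G (k + 1) = μ + σ * expectedMax (gaussianReal 0 1) (k + 1) := by
    rw [hGm, expectedMax_map haff hn, integral_add (integrable_const μ)
      ((integrable_iSup_pi integrable_id_stdNormal _).const_mul σ), integral_const_mul]
    simp [expectedMax]
  rw [← hGE, expectedMax_eq_censored_sub h.integrable_id r hn,
    expectedMax_eq_censored_sub hGi r hn, map_max_eq_of_restrict_Ici_eq (h.restrict_eq hσ)]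
  have hq : F.real (Iio r) = 1 - α := h.real_Iio_quantile hσ hα0 hα1
  have hGq : G.real (Iio r) = 1 - α := by
    have e := congrArg (fun P : Measure ℝ => (P univ).toReal) (h.restrict_eq hσ)
    simp only [Measure.restrict_apply_univ] at e
    rw [← compl_Ici, probReal_compl_eq_one_sub measurableSet_Ici, measureReal_def, ← e,
      ← measureReal_def, ← probReal_compl_eq_one_sub measurableSet_Ici, compl_Ici, hq]
  have hF1 := integral_shortfall_le h.integrable_id r k
  have hG1 := integral_shortfall_le hGi r k
  rw [hq] at hF1
  rw [hGq] at hG1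
  have hF0 : 0 ≤ ∫ x : Fin (k + 1) → ℝ, max (r - ⨆ i, x i) 0
      ∂(Measure.pi fun _ : Fin (k + 1) => F) := integral_nonneg fun _ => le_max_right _ _
  have hG0 : 0 ≤ ∫ x : Fin (k + 1) → ℝ, max (r - ⨆ i, x i) 0
      ∂(Measure.pi fun _ : Fin (k + 1) => G) := integral_nonneg fun _ => le_max_right _ _
  have hF2 : ∫ x, max (r - x) 0 ∂F ≤ 2 + CR / α + CR := by
    calc ∫ x, max (r - x) 0 ∂F ≤ ∫ x, (max r 0 + |x|) ∂F := by
          refine integral_mono (((integrable_const r).sub h.integrable_id).pos_part)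
            ((integrable_const _).add h.integrable_id.abs) fun x => max_le ?_ ?_
          · exact (sub_eq_add_neg r x).le.trans (add_le_add (le_max_left _ _) (neg_le_abs x))
          · exact add_nonneg (le_max_right _ _) (abs_nonneg x)
      _ = max r 0 + ∫ x, |x| ∂F := by
          rw [integral_add (integrable_const _) h.integrable_id.abs]
          simp
      _ ≤ _ := by linarith [h.quantile_le hσ hα0 hα1, h.integral_abs_le]
  have hG2 : ∫ x, max (r - x) 0 ∂G ≤ σ * (|z| + ∫ x, |x| ∂(gaussianReal 0 1)) := by
    rw [hGm, integral_map haffm (by fun_prop)]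
    calc ∫ x, max (r - (μ + σ * x)) 0 ∂(gaussianReal 0 1)
        ≤ ∫ x, σ * (|z| + |x|) ∂(gaussianReal 0 1) := by
          refine integral_mono (((integrable_const r).sub ((integrable_const μ).add
            (integrable_id_stdNormal.const_mul σ))).pos_part)
            (((integrable_const _).add integrable_id_stdNormal.abs).const_mul σ) fun x => ?_
          refine max_le ?_ (by positivity)
          have : r - (μ + σ * x) = σ * (z - x) := by rw [hrz]; ring
          rw [this]
          refine mul_le_mul_of_nonneg_left ?_ hσ.le
          linarith [le_abs_self z, neg_le_abs x]
      _ = _ := by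
          rw [integral_const_mul, integral_add (integrable_const _) integrable_id_stdNormal.abs]
          simp
  have hp : 0 ≤ (1 - α) ^ k := pow_nonneg (by linarith) k
  have hF3 := hF1.trans (mul_le_mul_of_nonneg_right hF2 hp)
  have hG3 := hG1.trans (mul_le_mul_of_nonneg_right hG2 hp)
  rw [abs_le]
  constructor <;> nlinarith

end GaussianTail

/-! ### Concentration of normal sample means -/

lemma exp_le_one_add_add_sq_mul_exp_abs (y : ℝ) :
    Real.exp y ≤ 1 + y + y ^ 2 * Real.exp |y| := by
  rcases le_total |y| 1 with h | h
  · have h1 := (abs_le.1 (Real.abs_exp_sub_one_sub_id_le h)).2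
    have h2 : 1 ≤ Real.exp |y| := Real.one_le_exp (abs_nonneg y)
    nlinarith [sq_nonneg y]
  · have h2 : 1 ≤ y ^ 2 := by nlinarith [sq_abs y]
    have h3 := Real.exp_pos |y|
    rcases le_total y 0 with hy | hy
    · have h4 : Real.exp y ≤ 1 := Real.exp_le_one_iff.2 hy
      have h5 : 1 ≤ Real.exp |y| := Real.one_le_exp (abs_nonneg y)
      rw [abs_of_nonpos hy] at h h5 ⊢
      nlinarith
    · rw [abs_of_nonneg hy] at h3 ⊢
      nlinarith

lemma integrable_exp_quarter_sq :
    Integrable (fun x : ℝ => Real.exp ((3 + x ^ 2) / 4)) (gaussianReal 0 1) := by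
  have h := (integrableOn_stdNormal_iff MeasurableSet.univ
    (fun x : ℝ => Real.exp ((3 + x ^ 2) / 4))).2
  rw [integrableOn_univ, integrableOn_univ] at h
  refine h (((integrable_exp_neg_mul_sq (b := 1 / 4) (by norm_num)).const_mul
    ((√(2 * Real.pi))⁻¹ * Real.exp (3 / 4))).congr ?_)
  filter_upwards with x
  rw [stdNormal_pdf, mul_assoc, mul_assoc, ← Real.exp_add, ← Real.exp_add]
  ring_nf

/-- The bound on the second-order term of the moment generating functions of all centred
statistics of at most quadratic growth. -/
noncomputable def bernsteinConst : ℝ :=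
  128 * ∫ x : ℝ, Real.exp ((3 + x ^ 2) / 4) ∂(gaussianReal 0 1)

lemma bernsteinConst_nonneg : 0 ≤ bernsteinConst :=
  mul_nonneg (by norm_num) (integral_nonneg fun x => (Real.exp_pos _).le)

lemma integrable_of_abs_le_one_add_sq {f : ℝ → ℝ} (hf : Measurable f)
    (hb : ∀ x, |f x| ≤ 1 + x ^ 2) : Integrable f (gaussianReal 0 1) :=
  ((integrable_const (1 : ℝ)).add (stdNormal_integrable_pow 2)).mono' hf.aestronglyMeasurable
    (by filter_upwards with x using hb x)

lemma integral_sq_stdNormal : ∫ x : ℝ, x ^ 2 ∂(gaussianReal 0 1) = 1 := by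
  have h := variance_fun_id_gaussianReal (μ := 0) (v := 1)
  rw [variance_eq_integral (by fun_prop), integral_id_gaussianReal] at h
  simpa using h

/-- For small exponents `l`, a centred statistic of at most quadratic growth of a standard normal
variable has a moment generating function bounded by `exp (l² B)`. -/
lemma mgf_centred_le {f : ℝ → ℝ} (hf : Measurable f) (hb : ∀ x, |f x| ≤ 1 + x ^ 2) {l : ℝ}
    (hl0 : 0 ≤ l) (hl : l ≤ 1 / 8) :
    Integrable (fun x => Real.exp (l * (f x - ∫ y, f y ∂(gaussianReal 0 1)))) (gaussianReal 0 1) ∧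
    ∫ x, Real.exp (l * (f x - ∫ y, f y ∂(gaussianReal 0 1))) ∂(gaussianReal 0 1) ≤
      Real.exp (l ^ 2 * bernsteinConst) := by
  set e := ∫ y, f y ∂(gaussianReal 0 1) with he
  have hfi := integrable_of_abs_le_one_add_sq hf hb
  have hE := integrable_exp_quarter_sq
  have hebd : |e| ≤ 2 := by
    calc |e| ≤ ∫ x, |f x| ∂(gaussianReal 0 1) := abs_integral_le_integral_abs
      _ ≤ ∫ x, (1 + x ^ 2) ∂(gaussianReal 0 1) :=
        integral_mono hfi.abs ((integrable_const _).add (stdNormal_integrable_pow 2)) hb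
      _ = 2 := by
        rw [integral_add (integrable_const _) (stdNormal_integrable_pow 2), integral_sq_stdNormal]
        norm_num
  have hg : ∀ x, |f x - e| ≤ 3 + x ^ 2 := fun x => by
    linarith [abs_sub (f x) e, hb x]
  have hle : ∀ x, |l * (f x - e)| ≤ (3 + x ^ 2) / 8 := fun x => by
    rw [abs_mul, abs_of_nonneg hl0]
    calc l * |f x - e| ≤ 1 / 8 * (3 + x ^ 2) :=
          mul_le_mul hl (hg x) (abs_nonneg _) (by norm_num)
      _ = _ := by ring
  have hsq : ∀ x, (f x - e) ^ 2 * Real.exp |l * (f x - e)| ≤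
      128 * Real.exp ((3 + x ^ 2) / 4) := fun x => by
    have h1 : (f x - e) ^ 2 ≤ 128 * Real.exp ((3 + x ^ 2) / 8) := by
      have h2 := Real.quadratic_le_exp_of_nonneg (x := (3 + x ^ 2) / 8) (by positivity)
      have h3 : (f x - e) ^ 2 ≤ (3 + x ^ 2) ^ 2 := by
        rw [← sq_abs]
        exact pow_le_pow_left₀ (abs_nonneg _) (hg x) 2
      nlinarith [sq_nonneg x]
    calc _ ≤ 128 * Real.exp ((3 + x ^ 2) / 8) * Real.exp ((3 + x ^ 2) / 8) :=
          mul_le_mul h1 (Real.exp_le_exp.2 (hle x)) (Real.exp_pos _).le (by positivity)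
      _ = _ := by rw [mul_assoc, ← Real.exp_add]; ring_nf
  have hint : Integrable (fun x => Real.exp (l * (f x - e))) (gaussianReal 0 1) := by
    refine hE.mono' (by fun_prop) ?_
    filter_upwards with x
    rw [Real.norm_eq_abs, abs_of_pos (Real.exp_pos _), Real.exp_le_exp]
    have := (le_abs_self _).trans (hle x)
    nlinarith [sq_nonneg x]
  refine ⟨hint, ?_⟩
  have hi1 : Integrable (fun x => l * (f x - e)) (gaussianReal 0 1) :=
    (hfi.sub (integrable_const e)).const_mul l
  have hi2 : Integrable (fun x : ℝ => l ^ 2 * (128 * Real.exp ((3 + x ^ 2) / 4)))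
    (gaussianReal 0 1) := (hE.const_mul 128).const_mul _
  calc ∫ x, Real.exp (l * (f x - e)) ∂(gaussianReal 0 1)
      ≤ ∫ x, (1 + l * (f x - e) + l ^ 2 * (128 * Real.exp ((3 + x ^ 2) / 4)))
          ∂(gaussianReal 0 1) := by
        refine integral_mono hint (((integrable_const _).add hi1).add hi2) fun x => ?_
        have h1 := exp_le_one_add_add_sq_mul_exp_abs (l * (f x - e))
        have h2 := mul_le_mul_of_nonneg_left (hsq x) (sq_nonneg l)
        have h3 : (l * (f x - e)) ^ 2 * Real.exp |l * (f x - e)| =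
          l ^ 2 * ((f x - e) ^ 2 * Real.exp |l * (f x - e)|) := by ring
        exact h1.trans (add_le_add_right (h3.le.trans h2) _)
    _ = 1 + l ^ 2 * bernsteinConst := by
        have hi3 : Integrable (fun x => 1 + l * (f x - e)) (gaussianReal 0 1) :=
          (integrable_const _).add hi1
        rw [integral_add hi3 hi2, integral_add (integrable_const _) hi1, integral_const_mul,
          integral_sub hfi (integrable_const _), integral_const_mul, integral_const_mul,
          ← he, bernsteinConst]
        simp
    _ ≤ Real.exp (l ^ 2 * bernsteinConst) := by
        linarith [Real.add_one_le_exp (l ^ 2 * bernsteinConst)]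

/-- One-sided Chernoff bound for the sum of a centred statistic. -/
lemma sum_centred_ge_le {f : ℝ → ℝ} (hf : Measurable f) (hb : ∀ x, |f x| ≤ 1 + x ^ 2) (m : ℕ)
    {t : ℝ} (ht0 : 0 ≤ t) (ht1 : t ≤ 1) :
    (Measure.pi fun _ : Fin m => gaussianReal 0 1).real
      {x | m * t ≤ ∑ j, (f (x j) - ∫ y, f y ∂(gaussianReal 0 1))} ≤
      Real.exp (-(1 / (4 * (bernsteinConst + 4)) * m * t ^ 2)) := by
  set e := ∫ y, f y ∂(gaussianReal 0 1) with he
  set B := bernsteinConst with hB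
  have hB0 : 0 ≤ B := bernsteinConst_nonneg
  -- the exponent that is optimal with `B + 4` in place of `B`, where `4` makes it at most `1 / 8`
  set l := t / (2 * (B + 4)) with hl
  have hl0 : 0 ≤ l := by positivity
  have hl8 : l ≤ 1 / 8 := by
    rw [hl, div_le_div_iff₀ (by positivity) (by norm_num)]
    nlinarith
  obtain ⟨hi, hm⟩ := mgf_centred_le hf hb hl0 hl8
  have hprod : ∀ x : Fin m → ℝ, Real.exp (l * ∑ j, (f (x j) - e)) =
      ∏ j, Real.exp (l * (f (x j) - e)) := fun x => by
    rw [Finset.mul_sum, Real.exp_sum]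
  have h := measure_ge_le_exp_mul_mgf (μ := Measure.pi fun _ : Fin m => gaussianReal 0 1)
    (X := fun x => ∑ j, (f (x j) - e)) (m * t) hl0 (by
      simp_rw [hprod]
      exact Integrable.fintype_prod (f := fun _ : Fin m => fun y => Real.exp (l * (f y - e)))
        fun _ => hi)
  refine h.trans ?_
  have hmgf : mgf (fun x : Fin m → ℝ => ∑ j, (f (x j) - e))
      (Measure.pi fun _ : Fin m => gaussianReal 0 1) l ≤ Real.exp (l ^ 2 * B) ^ m := by
    rw [mgf]
    simp_rw [hprod]
    rw [integral_fintype_prod_eq_pow (fun y => Real.exp (l * (f y - e))), Fintype.card_fin]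
    exact pow_le_pow_left₀ (integral_nonneg fun _ => (Real.exp_pos _).le) hm m
  calc _ ≤ Real.exp (-l * (m * t)) * Real.exp (l ^ 2 * B) ^ m :=
        mul_le_mul_of_nonneg_left hmgf (Real.exp_pos _).le
    _ ≤ _ := by
        rw [← Real.exp_nat_mul, ← Real.exp_add, Real.exp_le_exp]
        have e1 : l * (2 * (B + 4)) = t := by rw [hl]; field_simp
        have e2 : 1 / (4 * (B + 4)) * m * t ^ 2 = m * (l ^ 2 * (B + 4)) := by
          rw [← e1]
          field_simp
          ring
        rw [e2, ← e1]
        have : 0 ≤ (m : ℝ) * l ^ 2 := by positivity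
        nlinarith

/-- Sample means of statistics of at most quadratic growth concentrate, uniformly over the
statistic. -/
lemma exists_concentration : ∃ c : ℝ, 0 < c ∧ ∀ f : ℝ → ℝ, Measurable f →
    (∀ x, |f x| ≤ 1 + x ^ 2) → ∀ (m : ℕ) (t : ℝ), 0 ≤ t → t ≤ 1 →
    (Measure.pi fun _ : Fin m => gaussianReal 0 1).real
      {x | m * t ≤ |∑ j, f (x j) - m * ∫ y, f y ∂(gaussianReal 0 1)|} ≤
      2 * Real.exp (-(c * m * t ^ 2)) := by
  refine ⟨1 / (4 * (bernsteinConst + 4)), by have := bernsteinConst_nonneg; positivity,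
    fun f hf hb m t ht0 ht1 => ?_⟩
  have h1 := sum_centred_ge_le hf hb m ht0 ht1
  have h2 := sum_centred_ge_le hf.neg (by simpa using hb) m ht0 ht1
  refine (measureReal_mono (fun x hx => ?_)).trans ((measureReal_union_le _ _).trans
    ((add_le_add h1 h2).trans_eq (two_mul _).symm))
  rw [mem_ofPred_eq] at hx
  rcases le_abs.1 hx with h | h
  · left
    rw [mem_ofPred_eq, Finset.sum_sub_distrib]
    simpa using h
  · right
    rw [mem_ofPred_eq, Finset.sum_sub_distrib]
    simp only [Pi.neg_apply, integral_neg, Finset.sum_neg_distrib, Finset.sum_const,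
      Finset.card_univ, Fintype.card_fin, nsmul_eq_mul]
    linarith

/-! ### The tail estimator as a function of the data -/

lemma isLeast_empQuantile {m : ℕ} (hm : m ≠ 0) {p : ℝ} (hp0 : 0 < p) (hp1 : p ≤ 1)
    (d : Fin m → ℝ) :
    IsLeast {x : ℝ | p ≤ ((Finset.univ.filter fun j => d j ≤ x).card : ℝ) / m}
      (empQuantile p d) := by
  have hm' : (0 : ℝ) < m := by positivity
  have : Nonempty (Fin m) := ⟨⟨0, Nat.pos_of_ne_zero hm⟩⟩
  have hne : {y : ℝ | p ≤ ((Finset.univ.filter fun j => d j ≤ y).card : ℝ) / m}.Nonempty := by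
    refine ⟨⨆ j, d j, ?_⟩
    have : (Finset.univ.filter fun j => d j ≤ ⨆ j, d j) = Finset.univ :=
      Finset.filter_true_of_mem fun j _ => le_iSup_fin d j
    rw [mem_ofPred_eq, this, Finset.card_univ, Fintype.card_fin, div_self hm'.ne']
    exact hp1
  have hbdd : BddBelow {y : ℝ | p ≤ ((Finset.univ.filter fun j => d j ≤ y).card : ℝ) / m} := by
    refine ⟨Finset.univ.inf' Finset.univ_nonempty d, fun y hy => ?_⟩
    by_contra hlt
    have : (Finset.univ.filter fun j => d j ≤ y) = ∅ :=
      Finset.filter_false_of_mem fun j hj =>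
        not_le.2 ((not_le.1 hlt).trans_le (Finset.inf'_le d hj))
    rw [mem_ofPred_eq, this, Finset.card_empty, Nat.cast_zero, zero_div] at hy
    exact absurd hy (not_le.2 hp0)
  exact ⟨(isClosed_empQuantile_set p d).csInf_mem hne hbdd, fun y hy => csInf_le hbdd hy⟩

lemma empQuantile_eq_of_isLeast {m : ℕ} {p q : ℝ} {d : Fin m → ℝ}
    (h : IsLeast {x : ℝ | p ≤ ((Finset.univ.filter fun j => d j ≤ x).card : ℝ) / m} q) :
    empQuantile p d = q :=
  h.csInf_eq

lemma le_empQuantile {m : ℕ} (hm : m ≠ 0) {p : ℝ} (hp0 : 0 < p) (hp1 : p ≤ 1) {d : Fin m → ℝ}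
    {x : ℝ} (h : ((Finset.univ.filter fun j => d j ≤ x).card : ℝ) < p * m) :
    x ≤ empQuantile p d := by
  by_contra hlt
  have h1 : p ≤ _ := (isLeast_empQuantile hm hp0 hp1 d).1
  rw [le_div_iff₀ (by positivity)] at h1
  have h2 : (Finset.univ.filter fun j => d j ≤ empQuantile p d).card ≤
      (Finset.univ.filter fun j => d j ≤ x).card :=
    Finset.card_le_card (Finset.monotone_filter_right _ fun j _ hj => hj.trans (not_le.1 hlt).le)
  have h3 : ((Finset.univ.filter fun j => d j ≤ empQuantile p d).card : ℝ) ≤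
      (Finset.univ.filter fun j => d j ≤ x).card := by exact_mod_cast h2
  linarith

lemma empQuantile_le {m : ℕ} (hm : m ≠ 0) {p : ℝ} (hp0 : 0 < p) (hp1 : p ≤ 1) {d : Fin m → ℝ}
    {x : ℝ} (h : p * m ≤ ((Finset.univ.filter fun j => d j ≤ x).card : ℝ)) :
    empQuantile p d ≤ x :=
  (isLeast_empQuantile hm hp0 hp1 d).2 (by
    rw [mem_ofPred_eq, le_div_iff₀ (by positivity)]
    exact h)

lemma empQuantile_affine {m : ℕ} (hm : m ≠ 0) {p : ℝ} (hp0 : 0 < p) (hp1 : p ≤ 1)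
    (x : Fin m → ℝ) (μ : ℝ) {σ : ℝ} (hσ : 0 < σ) :
    empQuantile p (fun j => μ + σ * x j) = μ + σ * empQuantile p x := by
  have h := isLeast_empQuantile hm hp0 hp1 x
  have key : ∀ y j, μ + σ * x j ≤ y ↔ x j ≤ (y - μ) / σ := fun y j => by
    rw [le_div_iff₀ hσ]
    constructor <;> intro <;> linarith
  refine empQuantile_eq_of_isLeast ⟨?_, fun y hy => ?_⟩
  · simp only [mem_ofPred_eq, key]
    have e : (μ + σ * empQuantile p x - μ) / σ = empQuantile p x := by field_simp; ring
    rw [e]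
    exact h.1
  · simp only [mem_ofPred_eq, key] at hy
    have h2 := h.2 hy
    rw [le_div_iff₀ hσ] at h2
    linarith

section Affine

variable {α : ℝ} {m : ℕ} (x : Fin m → ℝ) (μ : ℝ) {σ : ℝ}

lemma tailSet_affine (hm : m ≠ 0) (hα0 : 0 < α) (hα1 : α < 1) (hσ : 0 < σ) :
    tailSet α (fun j => μ + σ * x j) = tailSet α x := by
  ext j
  simp only [tailSet, Finset.mem_filter, Finset.mem_univ, true_and]
  rw [empQuantile_affine hm (by linarith) (by linarith) x μ hσ]
  constructor
  · intro h
    exact le_of_mul_le_mul_left (by linarith) hσ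
  · intro h
    linarith [mul_le_mul_of_nonneg_left h hσ.le]

lemma tailMean_affine (hm : m ≠ 0) (hα0 : 0 < α) (hα1 : α < 1) (hσ : 0 < σ)
    (hT : ((tailSet α x).card : ℝ) ≠ 0) :
    tailMean α (fun j => μ + σ * x j) = μ + σ * tailMean α x := by
  rw [tailMean, tailMean, tailSet_affine x μ hm hα0 hα1 hσ, Finset.sum_add_distrib,
    ← Finset.mul_sum, Finset.sum_const, nsmul_eq_mul]
  field_simp

lemma sigmaHat_affine (hm : m ≠ 0) (hα0 : 0 < α) (hα1 : α < 1) (hσ : 0 < σ)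
    (hT : ((tailSet α x).card : ℝ) ≠ 0) :
    sigmaHat α (fun j => μ + σ * x j) = σ * sigmaHat α x := by
  have h : tailVar α (fun j => μ + σ * x j) = σ ^ 2 * tailVar α x := by
    rw [tailVar, tailVar, tailSet_affine x μ hm hα0 hα1 hσ,
      tailMean_affine x μ hm hα0 hα1 hσ hT, ← mul_div_assoc, Finset.mul_sum]
    congr 1
    exact Finset.sum_congr rfl fun j _ => by ring
  rw [sigmaHat, sigmaHat, h, mul_div_assoc, Real.sqrt_mul (sq_nonneg σ), Real.sqrt_sq hσ.le]

lemma predict_affine (hm : m ≠ 0) (hα0 : 0 < α) (hα1 : α < 1) (hσ : 0 < σ)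
    (hT : ((tailSet α x).card : ℝ) ≠ 0) (N : ℕ) :
    predict α N (fun j => μ + σ * x j) =
      μ + σ * (muHat α x + sigmaHat α x * expectedMax (gaussianReal 0 1) N) := by
  rw [predict, muHat, muHat, tailMean_affine x μ hm hα0 hα1 hσ hT,
    sigmaHat_affine x μ hm hα0 hα1 hσ hT]
  ring

end Affine

/-- The prediction only sees the data above the empirical quantile: data sets that agree after
censoring at a level below it have the same prediction. -/
lemma predict_eq_of_max_eq {α : ℝ} (hα0 : 0 < α) (hα1 : α < 1) {m : ℕ} (hm : m ≠ 0)
    {d d' : Fin m → ℝ} {r : ℝ} (hd : ∀ j, max (d j) r = max (d' j) r)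
    (hr : r < empQuantile (1 - α / 2) d) (N : ℕ) :
    empQuantile (1 - α / 2) d' = empQuantile (1 - α / 2) d ∧ predict α N d' = predict α N d := by
  have hp0 : 0 < 1 - α / 2 := by linarith
  have hp1 : 1 - α / 2 ≤ 1 := by linarith
  set q := empQuantile (1 - α / 2) d with hq
  have h := isLeast_empQuantile hm hp0 hp1 d
  have hle : ∀ y, r ≤ y → ∀ j, d j ≤ y ↔ d' j ≤ y := fun y hy j => by
    have h1 : max (d j) r ≤ y ↔ max (d' j) r ≤ y := by rw [hd j]
    simpa [hy] using h1
  have heq : empQuantile (1 - α / 2) d' = q := by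
    refine empQuantile_eq_of_isLeast ⟨?_, fun y hy => ?_⟩
    · have h1 := h.1
      simp only [mem_ofPred_eq, ← hq, hle q hr.le] at h1
      simpa only [mem_ofPred_eq] using h1
    · by_contra hlt
      -- `d` and `d'` agree above `r`, so `max y r` would be a level below the quantile of `d` that
      -- has enough data of `d` under it
      have hmax : 1 - α / 2 ≤
          ((Finset.univ.filter fun j => d j ≤ max y r).card : ℝ) / m := by
        simp only [hle _ (le_max_right y r)]
        refine le_trans (mem_ofPred_eq ▸ hy) ?_
        have : (Finset.univ.filter fun j => d' j ≤ y).card ≤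
            (Finset.univ.filter fun j => d' j ≤ max y r).card :=
          Finset.card_le_card (Finset.monotone_filter_right _ fun j _ hj =>
            hj.trans (le_max_left y r))
        gcongr
      exact absurd (h.2 hmax) (not_le.2 (max_lt (not_le.1 hlt) hr))
  refine ⟨heq, ?_⟩
  have htail : ∀ j, q ≤ d j → d' j = d j := fun j hj => by
    have h1 := hd j
    rw [max_eq_left (hr.le.trans hj)] at h1
    rcases max_choice (d' j) r with h2 | h2
    · rw [h1, h2]
    · rw [h2] at h1
      linarith
  have htail' : ∀ j, q ≤ d' j → d' j = d j := fun j hj => by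
    have h1 := hd j
    rw [max_eq_left (hr.le.trans hj)] at h1
    rcases max_choice (d j) r with h2 | h2
    · rw [← h1, h2]
    · rw [h2] at h1
      linarith
  have hset : tailSet α d' = tailSet α d := by
    ext j
    simp only [tailSet, Finset.mem_filter, Finset.mem_univ, true_and, heq, ← hq]
    exact ⟨fun hj => htail' j hj ▸ hj, fun hj => (htail j hj).symm ▸ hj⟩
  have hval : ∀ j ∈ tailSet α d, d' j = d j := fun j hj => by
    simp only [tailSet, Finset.mem_filter, Finset.mem_univ, true_and] at hj
    exact htail j hj
  have hmean : tailMean α d' = tailMean α d := by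
    rw [tailMean, tailMean, hset, Finset.sum_congr rfl hval]
  have hvar : tailVar α d' = tailVar α d := by
    rw [tailVar, tailVar, hset, hmean,
      Finset.sum_congr rfl fun j hj => by rw [hval j hj]]
  rw [predict, predict, muHat, muHat, sigmaHat, sigmaHat, hmean, hvar]

/-! ### Accuracy of the tail estimator on normal data -/

/-- Regularity of a sample `x` that is meant to be standard normal, with `z` the normal
`(1 - α / 2)`-quantile: enough points are on the right side of `z - t` and of `z + t` for the
empirical quantile to lie between them, few points lie between them, and the zeroth, first and
second empirical moments of the points above `z` are correct up to `t`. -/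
structure TailRegular (α t : ℝ) {m : ℕ} (x : Fin m → ℝ) : Prop where
  below : ∑ j, (Iic (quantile (gaussianReal 0 1) (1 - α / 2) - t)).indicator 1 (x j) <
    (1 - α / 2) * m
  above : (1 - α / 2) * m ≤
    ∑ j, (Iic (quantile (gaussianReal 0 1) (1 - α / 2) + t)).indicator 1 (x j)
  near : ∑ j, (Icc (quantile (gaussianReal 0 1) (1 - α / 2) - t)
    (quantile (gaussianReal 0 1) (1 - α / 2) + t)).indicator 1 (x j) ≤ 2 * t * m
  card : |∑ j, (Ici (quantile (gaussianReal 0 1) (1 - α / 2))).indicator 1 (x j) - α / 2 * m| ≤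
    t * m
  sum : |∑ j, (Ici (quantile (gaussianReal 0 1) (1 - α / 2))).indicator (fun y => y) (x j) -
    α / 2 * mills (quantile (gaussianReal 0 1) (1 - α / 2)) * m| ≤ t * m
  sum_sq : |∑ j, (Ici (quantile (gaussianReal 0 1) (1 - α / 2))).indicator (fun y => y ^ 2) (x j) -
    α / 2 * (1 + quantile (gaussianReal 0 1) (1 - α / 2) *
      mills (quantile (gaussianReal 0 1) (1 - α / 2))) * m| ≤ t * m

lemma card_filter_le_eq_sum {m : ℕ} (x : Fin m → ℝ) (y : ℝ) :
    ((Finset.univ.filter fun j => x j ≤ y).card : ℝ) = ∑ j, (Iic y).indicator 1 (x j) := by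
  rw [Finset.card_filter]
  push_cast
  exact Finset.sum_congr rfl fun j _ => by by_cases h : x j ≤ y <;> simp [h]

lemma TailRegular.empQuantile_mem {α t : ℝ} (hα0 : 0 < α) (hα1 : α < 1) {m : ℕ} (hm : m ≠ 0)
    {x : Fin m → ℝ} (h : TailRegular α t x) :
    empQuantile (1 - α / 2) x ∈ Icc (quantile (gaussianReal 0 1) (1 - α / 2) - t)
      (quantile (gaussianReal 0 1) (1 - α / 2) + t) :=
  ⟨le_empQuantile hm (by linarith) (by linarith) (by rw [card_filter_le_eq_sum]; exact h.below),
    empQuantile_le hm (by linarith) (by linarith) (by rw [card_filter_le_eq_sum]; exact h.above)⟩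

/-- Replacing the quantile by the empirical quantile changes a tail sum only through the points
between the two. -/
lemma TailRegular.abs_sum_tailSet_sub_le {α t : ℝ} (hα0 : 0 < α) (hα1 : α < 1) {m : ℕ}
    (hm : m ≠ 0) {x : Fin m → ℝ} (h : TailRegular α t x) (g : ℝ → ℝ) {B : ℝ} (hB : 0 ≤ B)
    (hg : ∀ y ∈ Icc (quantile (gaussianReal 0 1) (1 - α / 2) - t)
      (quantile (gaussianReal 0 1) (1 - α / 2) + t), |g y| ≤ B) :
    |∑ j ∈ tailSet α x, g (x j) -
      ∑ j, (Ici (quantile (gaussianReal 0 1) (1 - α / 2))).indicator g (x j)| ≤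
        B * (2 * t * m) := by
  obtain ⟨hq1, hq2⟩ := h.empQuantile_mem hα0 hα1 hm
  set z := quantile (gaussianReal 0 1) (1 - α / 2)
  rw [tailSet, Finset.sum_filter, ← Finset.sum_sub_distrib]
  refine (Finset.abs_sum_le_sum_abs _ _).trans ?_
  refine le_trans ?_ (mul_le_mul_of_nonneg_left h.near hB)
  rw [Finset.mul_sum]
  refine Finset.sum_le_sum fun j _ => ?_
  by_cases hj : x j ∈ Icc (z - t) (z + t)
  · rw [indicator_of_mem hj]
    have hgj := hg _ hj
    by_cases h1 : empQuantile (1 - α / 2) x ≤ x j <;> by_cases h2 : z ≤ x j <;>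
      simp [h1, h2, hgj, hB]
  · rw [indicator_of_notMem hj, mul_zero]
    have hzt : z - t ≤ z + t := hq1.trans hq2
    rcases lt_or_ge (x j) (z - t) with h3 | h3
    · rw [if_neg (by linarith), indicator_of_notMem (by rw [mem_Ici]; linarith)]
      simp
    · have h4 : z + t < x j := by
        by_contra hlt
        exact hj ⟨h3, not_lt.1 hlt⟩
      rw [if_pos (by linarith), indicator_of_mem (by rw [mem_Ici]; linarith)]
      simp

lemma abs_sqrt_sub_one_le {y : ℝ} (hy : 0 ≤ y) : |√y - 1| ≤ |y - 1| := by
  have h1 : y - 1 = (√y - 1) * (√y + 1) := by nlinarith [Real.sq_sqrt hy]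
  rw [h1, abs_mul]
  refine le_mul_of_one_le_right (abs_nonneg _) ?_
  rw [abs_of_nonneg (by positivity)]
  linarith [Real.sqrt_nonneg y]

/-- A ratio of approximations approximates the ratio. -/
lemma abs_div_sub_le {S T a b e m : ℝ} (hm : 0 < m) (ha : 0 < a) (he : e ≤ a / 2)
    (hT : |T - a * m| ≤ e * m) (hS : |S - a * b * m| ≤ e * m) :
    |S / T - b| ≤ 2 * (1 + |b|) / a * e := by
  have hT0 : a / 2 * m ≤ T := by
    have := (abs_le.1 hT).1
    nlinarith
  have hTpos : 0 < T := lt_of_lt_of_le (by positivity) hT0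
  have h1 : S / T - b = ((S - a * b * m) - b * (T - a * m)) / T := by
    field_simp
    ring
  have h2 : |(S - a * b * m) - b * (T - a * m)| ≤ (1 + |b|) * e * m := by
    refine (abs_sub _ _).trans ?_
    rw [abs_mul]
    nlinarith [mul_le_mul_of_nonneg_left hT (abs_nonneg b)]
  have he0 : 0 ≤ e := nonneg_of_mul_nonneg_left ((abs_nonneg _).trans hT) hm
  rw [h1, abs_div, abs_of_pos hTpos, div_le_iff₀ hTpos]
  calc _ ≤ (1 + |b|) * e * m := h2
    _ = 2 * (1 + |b|) / a * e * (a / 2 * m) := by field_simp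
    _ ≤ _ := mul_le_mul_of_nonneg_left hT0 (by positivity)

lemma tailVar_eq {α : ℝ} {m : ℕ} (x : Fin m → ℝ) (hT : ((tailSet α x).card : ℝ) ≠ 0) :
    tailVar α x = (∑ j ∈ tailSet α x, x j ^ 2) / ((tailSet α x).card : ℝ) - tailMean α x ^ 2 := by
  have h1 : ∑ j ∈ tailSet α x, x j = tailMean α x * ((tailSet α x).card : ℝ) := by
    rw [tailMean, div_mul_cancel₀ _ hT]
  have h2 : ∑ j ∈ tailSet α x, (x j - tailMean α x) ^ 2 =
      ∑ j ∈ tailSet α x, x j ^ 2 - tailMean α x ^ 2 * ((tailSet α x).card : ℝ) := by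
    have e : ∀ j, (x j - tailMean α x) ^ 2 =
        x j ^ 2 - 2 * tailMean α x * x j + tailMean α x ^ 2 := fun j => by ring
    simp_rw [e]
    rw [Finset.sum_add_distrib, Finset.sum_sub_distrib, ← Finset.mul_sum, h1, Finset.sum_const,
      nsmul_eq_mul]
    ring
  rw [tailVar, h2, sub_div, mul_div_assoc, div_self hT, mul_one]

set_option maxHeartbeats 1000000 in
/-- On regular normal samples the estimates of the mean `0` and the standard deviation `1` have
errors of the order of the irregularity. -/
lemma exists_estimator_accuracy {α : ℝ} (hα0 : 0 < α) (hα1 : α < 1) :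
    ∃ t₀ : ℝ, 0 < t₀ ∧ t₀ ≤ 1 ∧ ∃ C : ℝ, 0 < C ∧ ∀ (m : ℕ) (t : ℝ) (x : Fin m → ℝ), m ≠ 0 →
      0 ≤ t → t ≤ t₀ → TailRegular α t x → ((tailSet α x).card : ℝ) ≠ 0 ∧
        |muHat α x| ≤ C * t ∧ |sigmaHat α x - 1| ≤ C * t := by
  set z := quantile (gaussianReal 0 1) (1 - α / 2) with hz
  set l := mills z with hl
  set L := |z| + 1 with hL
  have hL1 : 1 ≤ L := by rw [hL]; linarith [abs_nonneg z]
  set D := 2 * L ^ 2 + 1 with hD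
  have hD3 : 3 ≤ D := by rw [hD]; nlinarith
  set C₁ := 2 * (1 + |l|) / (α / 2) * D with hC₁
  set C₂ := 2 * (1 + |1 + z * l|) / (α / 2) * D with hC₂
  have hC₁0 : 0 ≤ C₁ := by positivity
  have hC₂0 : 0 ≤ C₂ := by positivity
  set C₃ := (C₂ + C₁ * (2 * |l| + C₁)) / truncVar z with hC₃
  have hδ := truncVar_pos z
  have hC₃0 : 0 ≤ C₃ := by positivity
  set t₀ := min 1 (α / 4 / D) with ht₀
  refine ⟨t₀, by positivity, min_le_left _ _, C₁ + C₃ * (1 + |l|) + 1, by positivity, ?_⟩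
  intro m t x hm ht htt₀ h
  have hmr : (0 : ℝ) < m := by positivity
  have ht1 : t ≤ 1 := htt₀.trans (min_le_left _ _)
  have htD : D * t ≤ α / 2 / 2 := by
    have := htt₀.trans (min_le_right _ _)
    rw [le_div_iff₀ (by positivity)] at this
    linarith
  have hIcc : ∀ y ∈ Icc (z - t) (z + t), |y| ≤ L := fun y hy => by
    rw [hL, abs_le]
    constructor <;> linarith [hy.1, hy.2, neg_abs_le z, le_abs_self z]
  set T := ((tailSet α x).card : ℝ) with hT
  have hcard : |T - α / 2 * m| ≤ D * t * m := by
    have h1 := h.abs_sum_tailSet_sub_le hα0 hα1 hm 1 zero_le_one (fun y _ => by simp)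
    have h2 := h.card
    simp only [Pi.one_apply, Finset.sum_const, nsmul_eq_mul, mul_one, one_mul] at h1
    have h3 := abs_sub_le T _ (α / 2 * m) |>.trans (add_le_add h1 h2)
    nlinarith [mul_nonneg ht hmr.le]
  have hsum : |∑ j ∈ tailSet α x, x j - α / 2 * l * m| ≤ D * t * m := by
    have h1 := h.abs_sum_tailSet_sub_le hα0 hα1 hm (fun y => y) (by linarith : 0 ≤ L) hIcc
    have h3 := abs_sub_le (∑ j ∈ tailSet α x, x j) _ (α / 2 * l * m) |>.trans (add_le_add h1 h.sum)
    refine h3.trans ?_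
    have : (2 * L + 1) * (t * m) ≤ D * (t * m) :=
      mul_le_mul_of_nonneg_right (by rw [hD]; nlinarith) (mul_nonneg ht hmr.le)
    linarith
  have hsq : |∑ j ∈ tailSet α x, x j ^ 2 - α / 2 * (1 + z * l) * m| ≤ D * t * m := by
    have h1 := h.abs_sum_tailSet_sub_le hα0 hα1 hm (fun y => y ^ 2)
      (sq_nonneg L) (fun y hy => by
        simp only [abs_pow]
        exact pow_le_pow_left₀ (abs_nonneg _) (hIcc y hy) 2)
    have h3 := abs_sub_le (∑ j ∈ tailSet α x, x j ^ 2) _ (α / 2 * (1 + z * l) * m) |>.trans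
      (add_le_add h1 h.sum_sq)
    refine h3.trans_eq ?_
    rw [hD]
    ring
  have hT0 : T ≠ 0 := by
    have := (abs_le.1 hcard).1
    have h2 : D * t * m ≤ α / 2 / 2 * m := mul_le_mul_of_nonneg_right htD hmr.le
    have h3 : 0 < α / 2 / 2 * m := by positivity
    intro h0
    rw [h0] at this
    linarith
  have hmean : |tailMean α x - l| ≤ C₁ * t :=
    (abs_div_sub_le hmr (by positivity) htD hcard hsum).trans_eq (by rw [hC₁]; ring)
  have hsec : |(∑ j ∈ tailSet α x, x j ^ 2) / T - (1 + z * l)| ≤ C₂ * t :=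
    (abs_div_sub_le hmr (by positivity) htD hcard hsq).trans_eq (by rw [hC₂]; ring)
  have hmsq : |tailMean α x ^ 2 - l ^ 2| ≤ C₁ * (2 * |l| + C₁) * t := by
    have e : tailMean α x ^ 2 - l ^ 2 = (tailMean α x - l) * ((tailMean α x - l) + 2 * l) := by
      ring
    have h1 : |(tailMean α x - l) + 2 * l| ≤ C₁ + 2 * |l| := by
      refine (abs_add_le _ _).trans ?_
      rw [abs_mul, abs_two]
      nlinarith
    rw [e, abs_mul]
    calc _ ≤ C₁ * t * (C₁ + 2 * |l|) := mul_le_mul hmean h1 (abs_nonneg _) (by positivity)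
      _ = _ := by ring
  have hvar : |tailVar α x / truncVar z - 1| ≤ C₃ * t := by
    have e : tailVar α x / truncVar z - 1 = (((∑ j ∈ tailSet α x, x j ^ 2) / T - (1 + z * l)) -
        (tailMean α x ^ 2 - l ^ 2)) / truncVar z := by
      rw [tailVar_eq x hT0, div_sub_one hδ.ne']
      congr 1
      rw [truncVar]
      ring
    rw [e, abs_div, abs_of_pos hδ, div_le_iff₀ hδ]
    refine (abs_sub _ _).trans ((add_le_add hsec hmsq).trans_eq ?_)
    rw [hC₃]
    field_simp
  have hσ : |sigmaHat α x - 1| ≤ C₃ * t := by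
    refine (abs_sqrt_sub_one_le ?_).trans hvar
    exact div_nonneg (div_nonneg (Finset.sum_nonneg fun _ _ => sq_nonneg _) (Nat.cast_nonneg _))
      hδ.le
  have hμ : |muHat α x| ≤ C₁ * t + C₃ * t * |l| := by
    have e : muHat α x = (tailMean α x - l) - (sigmaHat α x - 1) * l := by
      rw [muHat]
      ring
    rw [e]
    refine (abs_sub _ _).trans (add_le_add hmean ?_)
    rw [abs_mul]
    exact mul_le_mul_of_nonneg_right hσ (abs_nonneg _)
  have n1 := mul_nonneg hC₁0 ht
  have n2 := mul_nonneg hC₃0 ht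
  have n3 := mul_nonneg n2 (abs_nonneg l)
  have e : (C₁ + C₃ * (1 + |l|) + 1) * t = C₁ * t + C₃ * t + C₃ * t * |l| + t := by ring
  refine ⟨hT0, hμ.trans ?_, hσ.trans ?_⟩ <;> rw [e] <;> linarith

/-! ### Probability of accurate predictions -/

/-- Near a point the normal distribution function grows at least linearly. -/
lemma exists_stdNormal_cdf_growth (z : ℝ) : ∃ k : ℝ, 0 < k ∧ k ≤ 1 ∧ ∀ t, 0 ≤ t → t ≤ 1 →
    cdf (gaussianReal 0 1) (z - t) ≤ cdf (gaussianReal 0 1) z - k * t ∧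
      cdf (gaussianReal 0 1) z + k * t ≤ cdf (gaussianReal 0 1) (z + t) := by
  obtain ⟨y, hy, hmin⟩ := isCompact_Icc.exists_isMinOn
    (nonempty_Icc.2 (by linarith : z - 1 ≤ z + 1)) continuous_stdNormal_pdf.continuousOn
  have hk := stdNormal_pdf_pos y
  have hk1 : gaussianPDFReal 0 1 y ≤ 1 := (stdNormal_pdf_le y).trans (by norm_num)
  have key : ∀ a b, z - 1 ≤ a → a ≤ b → b ≤ z + 1 → gaussianPDFReal 0 1 y * (b - a) ≤
      cdf (gaussianReal 0 1) b - cdf (gaussianReal 0 1) a := fun a b ha hab hb => by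
    rw [stdNormal_cdf_sub]
    have h := intervalIntegral.integral_mono_on hab
      (intervalIntegrable_const (c := gaussianPDFReal 0 1 y) (μ := volume))
      (continuous_stdNormal_pdf.intervalIntegrable a b) fun x hx =>
        hmin ⟨ha.trans hx.1, hx.2.trans hb⟩
    rw [intervalIntegral.integral_const, smul_eq_mul] at h
    linarith
  refine ⟨_, hk, hk1, fun t ht0 ht1 => ⟨?_, ?_⟩⟩
  · have := key (z - t) z (by linarith) (by linarith) (by linarith)
    have e : z - (z - t) = t := by ring
    rw [e] at this
    linarith
  · have := key z (z + t) (by linarith) (by linarith) (by linarith)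
    have e : z + t - z = t := by ring
    rw [e] at this
    linarith

lemma stdNormal_cdf_sub_le {a b : ℝ} (hab : a ≤ b) :
    cdf (gaussianReal 0 1) b - cdf (gaussianReal 0 1) a ≤ (b - a) / 2 := by
  rw [stdNormal_cdf_sub]
  have h := intervalIntegral.integral_mono_on hab
    (continuous_stdNormal_pdf.intervalIntegrable a b)
    (intervalIntegrable_const (c := (1 / 2 : ℝ)) (μ := volume)) fun x _ => stdNormal_pdf_le x
  rw [intervalIntegral.integral_const, smul_eq_mul] at h
  linarith

/-- Irregular normal samples are exponentially rare: each of the six conditions is implied by the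
concentration of one statistic. The deviation `k * t` used for this is small enough for the
distribution function to gain it over a distance `t`. -/
lemma exists_tailRegular_prob {α : ℝ} (hα0 : 0 < α) (hα1 : α < 1) :
    ∃ c : ℝ, 0 < c ∧ ∀ (m : ℕ) (t : ℝ), m ≠ 0 → 0 < t → t ≤ 1 →
      (Measure.pi fun _ : Fin m => gaussianReal 0 1).real {x | ¬ TailRegular α t x} ≤
        12 * Real.exp (-(c * m * t ^ 2)) := by
  obtain ⟨c, hc, hconc⟩ := exists_concentration
  set z := quantile (gaussianReal 0 1) (1 - α / 2) with hz
  have hΦz : cdf (gaussianReal 0 1) z = 1 - α / 2 :=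
    stdNormal_cdf_quantile (by linarith) (by linarith)
  obtain ⟨k, hk, hk1, hgrow⟩ := exists_stdNormal_cdf_growth z
  refine ⟨c * k ^ 2, by positivity, fun m t hm ht0 ht1 => ?_⟩
  have hmr : (0 : ℝ) < m := by positivity
  set P := Measure.pi fun _ : Fin m => gaussianReal 0 1 with hP
  obtain ⟨hlow, hhigh⟩ := hgrow t ht0.le ht1
  rw [hΦz] at hlow hhigh
  have hkt1 : k * t ≤ t := mul_le_of_le_one_left ht0.le hk1
  set ε := 2 * Real.exp (-(c * k ^ 2 * m * t ^ 2)) with hε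
  -- deviations of the mean of `f` by at least `k * t` are rare
  have hdev : ∀ f : ℝ → ℝ, Measurable f → (∀ x, |f x| ≤ 1 + x ^ 2) →
      P.real {x | m * (k * t) ≤ |∑ j, f (x j) - m * ∫ y, f y ∂(gaussianReal 0 1)|} ≤ ε :=
    fun f hf hb => by
      refine (hconc f hf hb m (k * t) (by positivity) (hkt1.trans ht1)).trans_eq ?_
      rw [hε]
      ring_nf
  have hind : ∀ s : Set ℝ, ∀ x : ℝ, |s.indicator (1 : ℝ → ℝ) x| ≤ 1 + x ^ 2 := fun s x => by
    by_cases hx : x ∈ s <;> simp [hx] <;> nlinarith [sq_nonneg x]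
  have d1 := hdev ((Iic (z - t)).indicator 1) (measurable_one.indicator measurableSet_Iic) (hind _)
  have d2 := hdev ((Iic (z + t)).indicator 1) (measurable_one.indicator measurableSet_Iic) (hind _)
  have d3 := hdev ((Icc (z - t) (z + t)).indicator 1) (measurable_one.indicator measurableSet_Icc)
    (hind _)
  have d4 := hdev ((Ici z).indicator 1) (measurable_one.indicator measurableSet_Ici) (hind _)
  have d5 := hdev ((Ici z).indicator fun y => y) (measurable_id.indicator measurableSet_Ici)
    (fun x => by
      by_cases hx : x ∈ Ici z <;> simp only [indicator_of_mem, indicator_of_notMem, hx,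
        not_false_eq_true, abs_zero]
      · nlinarith [sq_abs x, sq_nonneg (|x| - 1)]
      · positivity)
  have d6 := hdev ((Ici z).indicator fun y => y ^ 2)
    ((measurable_id.pow_const 2).indicator measurableSet_Ici)
    (fun x => by
      by_cases hx : x ∈ Ici z <;> simp only [indicator_of_mem, indicator_of_notMem, hx,
        not_false_eq_true, abs_zero]
      · rw [abs_of_nonneg (sq_nonneg x)]
        linarith
      · positivity)
  rw [integral_indicator_one measurableSet_Iic, stdNormal_real_Iic] at d1 d2
  rw [integral_indicator_one measurableSet_Icc, stdNormal_real_Icc (by linarith)] at d3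
  rw [integral_indicator_one measurableSet_Ici, stdNormal_real_Ici, hΦz] at d4
  rw [integral_indicator measurableSet_Ici, integral_Ici_eq_integral_Ioi,
    setIntegral_Ioi_id_stdNormal] at d5
  rw [integral_indicator measurableSet_Ici, integral_Ici_eq_integral_Ioi,
    setIntegral_Ioi_sq_stdNormal, hΦz] at d6
  have hmills : gaussianPDFReal 0 1 z = α / 2 * mills z := by
    rw [mills, hΦz, sub_sub_cancel, mul_div_cancel₀ _ (by positivity)]
  rw [hmills] at d5 d6
  refine (measureReal_mono ?_ (measure_ne_top _ _)).trans
    ((measureReal_union_le _ _).trans ((add_le_add ((measureReal_union_le _ _).trans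
      (add_le_add ((measureReal_union_le _ _).trans (add_le_add ((measureReal_union_le _ _).trans
        (add_le_add ((measureReal_union_le _ _).trans (add_le_add d1 d2)) d3)) d4)) d5))
          d6).trans_eq (by rw [hε]; ring)))
  intro x hx
  by_contra hnot
  simp only [mem_union, mem_ofPred_eq, not_or, not_le] at hnot
  obtain ⟨⟨⟨⟨⟨h1, h2⟩, h3⟩, h4⟩, h5⟩, h6⟩ := hnot
  have hmt : m * (k * t) ≤ t * m := by nlinarith
  refine hx ⟨?_, ?_, ?_, ?_, ?_, ?_⟩
  · have := (abs_lt.1 h1).2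
    nlinarith
  · have := (abs_lt.1 h2).1
    nlinarith
  · have := (abs_lt.1 h3).2
    have h7 := stdNormal_cdf_sub_le (a := z - t) (b := z + t) (by linarith)
    nlinarith
  · have e : ((m : ℝ) * (1 - (1 - α / 2))) = α / 2 * m := by ring
    rw [e] at h4
    exact h4.le.trans hmt
  · have e : (m : ℝ) * (α / 2 * mills z) = α / 2 * mills z * m := by ring
    rw [e] at h5
    exact h5.le.trans hmt
  · have e : (m : ℝ) * (z * (α / 2 * mills z) + (1 - (1 - α / 2))) =
        α / 2 * (1 + z * mills z) * m := by ring
    rw [e] at h6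
    exact h6.le.trans hmt

/-- With high probability the prediction from `m` rewards of a law with a Gaussian tail is within
`C log N / √m` of the Gaussian value `μ + σ E(N)`. -/
lemma exists_predict_accuracy {α : ℝ} (hα0 : 0 < α) (hα1 : α < 1) {σmax : ℝ} (hσmax : 0 < σmax) :
    ∃ c₀ : ℝ, 0 < c₀ ∧ ∃ C : ℝ, 0 < C ∧ ∀ (CR : ℝ) (F : Measure ℝ) [IsProbabilityMeasure F]
      (μ σ : ℝ), GaussianTail α CR F μ σ → 0 < σ → σ ≤ σmax → ∀ N m : ℕ, 2 ≤ N →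
        c₀ * Real.log N ≤ m →
      (Measure.pi fun _ : Fin m => F).real {d | C * (Real.log N / √m) <
        |predict α N d - (μ + σ * expectedMax (gaussianReal 0 1) N)|} ≤ 12 / (N : ℝ) ^ 3 := by
  obtain ⟨c, hc, hprob⟩ := exists_tailRegular_prob hα0 hα1
  obtain ⟨t₀, ht₀, ht₀1, C, hC, hacc⟩ := exists_estimator_accuracy hα0 hα1
  set z := quantile (gaussianReal 0 1) (1 - α / 2) with hz
  set z₁ := quantile (gaussianReal 0 1) (1 - α) with hz₁
  have hzz : z₁ < z := by
    rw [← strictMono_stdNormal_cdf.lt_iff_lt, stdNormal_cdf_quantile (by linarith) (by linarith),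
      stdNormal_cdf_quantile (by linarith) (by linarith)]
    linarith
  set t₁ := min t₀ ((z - z₁) / 2) with ht₁
  have ht₁0 : 0 < t₁ := lt_min ht₀ (by linarith)
  -- `t = √(A log N / m)` makes the failure probability of order `N⁻³`
  set A := 3 / c with hA
  have hA0 : 0 < A := by positivity
  refine ⟨A / t₁ ^ 2, by positivity, 6 * σmax * C * √A, by positivity, ?_⟩
  intro CR F _ μ σ hF hσ0 hσ N m hN hm
  have hNr : (2 : ℝ) ≤ N := by exact_mod_cast hN
  have hlog2 : Real.log 2 ≤ Real.log N := Real.log_le_log (by norm_num) hNr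
  have hl2 := Real.log_two_gt_d9
  have hlog : 0 < Real.log N := by linarith
  have hmr : (0 : ℝ) < m := lt_of_lt_of_le (by positivity) hm
  have hm0 : m ≠ 0 := by
    rintro rfl
    simp at hmr
  set t := √(A * Real.log N / m) with ht
  have htpos : 0 < t := Real.sqrt_pos.2 (by positivity)
  have htsq : t ^ 2 = A * Real.log N / m := Real.sq_sqrt (by positivity)
  have htt₁ : t ≤ t₁ := by
    refine Real.sqrt_le_iff.2 ⟨ht₁0.le, ?_⟩
    rw [div_mul_eq_mul_div, div_le_iff₀ (by positivity)] at hm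
    rw [div_le_iff₀ hmr]
    linarith
  have htt₀ : t ≤ t₀ := htt₁.trans (min_le_left _ _)
  have htz : t ≤ (z - z₁) / 2 := htt₁.trans (min_le_right _ _)
  set v := μ + σ * expectedMax (gaussianReal 0 1) N with hv
  set r := quantile F (1 - α) with hr
  have hrz : r = μ + σ * z₁ := hF.quantile_eq hσ0 hα0 hα1
  set ε := 6 * σmax * C * √A * (Real.log N / √m) with hε
  -- the data sets with an accurate prediction that does not see the law below `r`
  set good : Set (Fin m → ℝ) := {d | r < empQuantile (1 - α / 2) d ∧ |predict α N d - v| ≤ ε}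
    with hgood
  have hgoodm : MeasurableSet good :=
    (measurableSet_lt measurable_const (measurable_empQuantile _)).inter
      (measurableSet_le ((measurable_predict α N).sub_const v).abs measurable_const)
  have hcens : Measurable fun y : ℝ => max y r := by fun_prop
  have haff : Measurable fun y : ℝ => max (μ + σ * y) r := by fun_prop
  have hcens' : Measurable fun (d : Fin m → ℝ) j => max (d j) r :=
    measurable_pi_lambda _ fun j => hcens.comp (measurable_pi_apply j)
  have haff' : Measurable fun (x : Fin m → ℝ) j => max (μ + σ * x j) r :=
    measurable_pi_lambda _ fun j => haff.comp (measurable_pi_apply j)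
  have step1 : {d : Fin m → ℝ | ε < |predict α N d - v|} ⊆
      (fun d j => max (d j) r) ⁻¹' goodᶜ := by
    intro d hd hg
    obtain ⟨hg1, hg2⟩ := hg
    have := (predict_eq_of_max_eq hα0 hα1 hm0 (d := fun j => max (d j) r) (d' := d)
      (fun j => by simp) hg1 N).2
    rw [mem_ofPred_eq, this] at hd
    exact absurd hg2 (not_le.2 hd)
  have step2 : (fun (x : Fin m → ℝ) j => max (μ + σ * x j) r) ⁻¹' goodᶜ ⊆
      {x | ¬ TailRegular α t x} := by
    intro x hx hreg
    apply hx
    obtain ⟨hT, hμ, hσ'⟩ := hacc m t x hm0 htpos.le htt₀ hreg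
    have hq := (hreg.empQuantile_mem hα0 hα1 hm0).1
    have hq2 : r < empQuantile (1 - α / 2) fun j => μ + σ * x j := by
      rw [empQuantile_affine hm0 (by linarith) (by linarith) x μ hσ0, hrz]
      have : z₁ < empQuantile (1 - α / 2) x := lt_of_lt_of_le (by linarith) hq
      linarith [mul_lt_mul_of_pos_left this hσ0]
    obtain ⟨e1, e2⟩ := predict_eq_of_max_eq hα0 hα1 hm0 (d := fun j => μ + σ * x j)
      (d' := fun j => max (μ + σ * x j) r) (fun j => by simp) hq2 N
    refine ⟨by rw [e1]; exact hq2, ?_⟩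
    rw [e2, predict_affine x μ hm0 hα0 hα1 hσ0 hT]
    set E := expectedMax (gaussianReal 0 1) N with hE
    have hE0 : 0 ≤ E := expectedMax_stdNormal_nonneg N
    have e3 : μ + σ * (muHat α x + sigmaHat α x * E) - v =
        σ * (muHat α x + (sigmaHat α x - 1) * E) := by
      rw [hv]
      ring
    have hs1 : 1 ≤ 2 * √(Real.log N) := by
      have : (1 / 2 : ℝ) ≤ √(Real.log N) := Real.le_sqrt_of_sq_le (by linarith)
      linarith
    have hs2 : √(2 * Real.log N) ≤ 2 * √(Real.log N) := by
      rw [Real.sqrt_mul (by norm_num)]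
      refine mul_le_mul_of_nonneg_right ?_ (Real.sqrt_nonneg _)
      exact Real.sqrt_le_iff.2 ⟨by norm_num, by norm_num⟩
    have hEle : 1 + E ≤ 6 * √(Real.log N) := by
      linarith [expectedMax_stdNormal_le hN]
    have hteq : t * √(Real.log N) = √A * (Real.log N / √m) := by
      rw [ht, Real.sqrt_div (by positivity), Real.sqrt_mul hA0.le, div_mul_eq_mul_div, mul_assoc,
        Real.mul_self_sqrt hlog.le, mul_div_assoc]
    rw [e3, abs_mul, abs_of_pos hσ0]
    calc σ * |muHat α x + (sigmaHat α x - 1) * E| ≤ σmax * (C * t * (1 + E)) := by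
          refine mul_le_mul hσ ?_ (abs_nonneg _) hσmax.le
          refine (abs_add_le _ _).trans ?_
          rw [abs_mul, abs_of_nonneg hE0]
          linarith [mul_le_mul_of_nonneg_right hσ' hE0]
      _ ≤ σmax * (C * t * (6 * √(Real.log N))) := by gcongr
      _ = 6 * σmax * C * (t * √(Real.log N)) := by ring
      _ = ε := by rw [hteq, hε]; ring
  have hmapF : (Measure.pi fun _ : Fin m => F).map (fun d j => max (d j) r) =
      (Measure.pi fun _ : Fin m => gaussianReal 0 1).map (fun x j => max (μ + σ * x j) r) := by
    rw [← pi_map_comp F hcens, ← pi_map_comp (gaussianReal 0 1) haff]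
    congr 1
    ext1 _
    exact hF.map_max_eq hσ0
  calc _ ≤ (Measure.pi fun _ : Fin m => F).real ((fun d j => max (d j) r) ⁻¹' goodᶜ) :=
        measureReal_mono step1 (measure_ne_top _ _)
    _ = (Measure.pi fun _ : Fin m => gaussianReal 0 1).real
          ((fun (x : Fin m → ℝ) j => max (μ + σ * x j) r) ⁻¹' goodᶜ) := by
        rw [← map_measureReal_apply hcens' hgoodm.compl, hmapF,
          map_measureReal_apply haff' hgoodm.compl]
    _ ≤ _ := measureReal_mono step2 (measure_ne_top _ _)
    _ ≤ 12 * Real.exp (-(c * m * t ^ 2)) := hprob m t hm0 htpos (htt₀.trans ht₀1)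
    _ = 12 / (N : ℝ) ^ 3 := by
        have e : c * m * t ^ 2 = 3 * Real.log N := by
          rw [htsq, hA]
          field_simp
        have e2 : Real.exp (3 * Real.log N) = (N : ℝ) ^ 3 := by
          have := Real.exp_nat_mul (Real.log N) 3
          rw [Real.exp_log (by linarith)] at this
          exact_mod_cast this
        rw [e, Real.exp_neg, e2]
        rfl

/-! ### Comparison of values -/

lemma GaussianTail.mono {α CR CR' : ℝ} {F : Measure ℝ} {μ σ : ℝ} (h : GaussianTail α CR F μ σ)
    (hCR : CR ≤ CR') : GaussianTail α CR' F μ σ :=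
  ⟨h.tail, h.integrable_sq, h.second_moment_le.trans hCR⟩

lemma exists_add_two_mul_pow_le {ρ : ℝ} (h0 : 0 ≤ ρ) (h1 : ρ < 1) :
    ∃ D : ℝ, 0 < D ∧ ∀ k : ℕ, ((k : ℝ) + 2) * ρ ^ k ≤ D := by
  have h := (tendsto_self_mul_const_pow_of_lt_one h0 h1).add
    ((tendsto_pow_atTop_nhds_zero_of_lt_one h0 h1).const_mul 2)
  obtain ⟨D, hD⟩ := h.bddAbove_range
  refine ⟨max D 1, by positivity, fun k => ?_⟩
  have := hD (mem_range_self k)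
  refine le_trans (le_of_eq ?_) (this.trans (le_max_left _ _))
  ring

/-- If the Gaussian value for budget `N` of the first law is nearly as large as that of the second
law, then `N / 2` draws from the first are nearly as good as `K` draws from the second, for `K` at
most a small multiple of `N`. The surplus that `N / 2` draws from the second law have over `K`
draws makes up for the loss from comparing the Gaussian values at `N` instead of `N / 2`. -/
lemma exists_value_comparison {α σmin σmax CR : ℝ} (hα0 : 0 < α) (hα1 : α < 1) (hσmin : 0 < σmin)
    (hσ : σmin ≤ σmax) (hCR : 0 ≤ CR) :
    ∃ Q : ℕ, 0 < Q ∧ ∃ C : ℝ, 0 < C ∧ ∀ (F F' : Measure ℝ) [IsProbabilityMeasure F]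
      [IsProbabilityMeasure F'] (μ σ μ' σ' : ℝ), GaussianTail α CR F μ σ →
      GaussianTail α CR F' μ' σ' → σ ∈ Icc σmin σmax → σ' ∈ Icc σmin σmax →
      ∀ N K n : ℕ, 4 * Q ≤ N → K ≠ 0 → K ≤ N / (2 * Q) → N / 2 ≤ n →
        expectedMax F' K - C / N - ((μ' + σ' * expectedMax (gaussianReal 0 1) N) -
          (μ + σ * expectedMax (gaussianReal 0 1) N)) ≤ expectedMax F n := by
  obtain ⟨D, hD0, hD⟩ := exists_add_two_mul_pow_le (ρ := 1 - α) (by linarith) (by linarith)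
  obtain ⟨Q, hQ⟩ := exists_nat_ge (3 / 2 * Real.exp ((σmax - σmin) / σmin))
  have hQpos : (0 : ℝ) < Q := lt_of_lt_of_le (by positivity) hQ
  have hQ0 : 0 < Q := by exact_mod_cast hQpos
  set B := σmax * (|quantile (gaussianReal 0 1) (1 - α)| + ∫ x, |x| ∂(gaussianReal 0 1)) +
    (2 + CR / α + CR) with hB
  have hI0 : 0 ≤ ∫ x, |x| ∂(gaussianReal 0 1) := integral_nonneg fun x => abs_nonneg x
  have hσmax : 0 < σmax := hσmin.trans_le hσ
  have hB0 : 0 < B := by positivity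
  refine ⟨Q, hQ0, 4 * B * D * Q, by positivity, ?_⟩
  intro F F' _ _ μ σ μ' σ' hF hF' hσm hσm' N K n hN hK hKN hn
  set E := expectedMax (gaussianReal 0 1) with hE
  set h := N / 2 with hh
  set L := N / (2 * Q) with hL
  have hLh : L = h / Q := by rw [hL, hh, Nat.div_div_eq_div_mul]
  have hh2 : 2 * Q ≤ h := by lia
  have hL2 : 2 ≤ L := by rw [hLh, Nat.le_div_iff_mul_le hQ0]; exact hh2
  have hLleh : L ≤ h := by rw [hLh]; exact Nat.div_le_self _ _
  have hσ0 := hσmin.trans_le hσm.1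
  have hσ0' := hσmin.trans_le hσm'.1
  have hNpos : (0 : ℝ) < N := by
    have : 0 < N := by lia
    exact_mod_cast this
  -- the Gaussian approximations of the two values
  have hpow : ∀ k, L ≤ k → (1 - α) ^ (k - 1) ≤ (1 - α) ^ (L - 1) := fun k hk =>
    pow_le_pow_of_le_one (by linarith) (by linarith) (by lia)
  have happ : ∀ (G : Measure ℝ) [IsProbabilityMeasure G] (m s : ℝ), GaussianTail α CR G m s →
      s ∈ Icc σmin σmax → ∀ k, L ≤ k →
        |expectedMax G k - (m + s * E k)| ≤ B * (1 - α) ^ (L - 1) := fun G _ m s hG hs k hk => by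
    refine (hG.abs_expectedMax_sub_le (hσmin.trans_le hs.1) hα0 hα1 (by lia)).trans ?_
    refine mul_le_mul ?_ (hpow k hk) (pow_nonneg (by linarith) _) hB0.le
    rw [hB]
    gcongr
    exact hs.2
  have herr : B * (1 - α) ^ (L - 1) ≤ 2 * B * D * Q / N := by
    have h1 := hD (L - 1)
    have h2 : ((L - 1 : ℕ) : ℝ) = (L : ℝ) - 1 := by
      rw [Nat.cast_sub (by lia)]
      simp
    have h3 : (N : ℝ) ≤ 2 * Q * (L + 1) := by
      have := Nat.lt_mul_div_succ N (show 0 < 2 * Q by lia)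
      exact_mod_cast this.le
    have hp : 0 ≤ (1 - α) ^ (L - 1) := pow_nonneg (by linarith) _
    rw [h2] at h1
    rw [le_div_iff₀ hNpos]
    calc B * (1 - α) ^ (L - 1) * N ≤ B * (1 - α) ^ (L - 1) * (2 * Q * (L + 1)) := by gcongr
      _ = 2 * B * Q * (((L : ℝ) - 1 + 2) * (1 - α) ^ (L - 1)) := by ring
      _ ≤ 2 * B * Q * D := by gcongr
      _ = 2 * B * D * Q := by ring
  have a1 := (abs_le.1 (happ F μ σ hF hσm h hLleh)).1
  have a2 := (abs_le.1 (happ F' μ' σ' hF' hσm' L le_rfl)).2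
  have m1 : expectedMax F h ≤ expectedMax F n := expectedMax_mono hF.integrable_id (by lia) hn
  have m2 : expectedMax F' K ≤ expectedMax F' L := expectedMax_mono hF'.integrable_id hK hKN
  -- the surplus of `h = N / 2` over `L = N / (2 Q)` draws against that of `N` over `h` draws
  have g0 : 0 ≤ gain h := gain_nonneg (by lia)
  have g1 : E N - E h ≤ gain h := expectedMax_sub_le_gain (by lia) (by lia) (by lia)
  have g2 : (σmax - σmin) / σmin * gain h ≤ E h - E L := by
    refine le_trans ?_ (gain_mul_log_le (by lia) hLleh)
    rw [mul_comm]
    refine mul_le_mul_of_nonneg_left ?_ g0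
    rw [Real.le_log_iff_exp_le (by positivity), le_div_iff₀ (by positivity)]
    have hLQ : (L : ℝ) * Q ≤ h := by
      have := Nat.div_mul_le_self h Q
      rw [← hLh] at this
      exact_mod_cast this
    have hL2r : (2 : ℝ) ≤ L := by exact_mod_cast hL2
    calc Real.exp ((σmax - σmin) / σmin) * ((L : ℝ) + 1)
        ≤ (2 / 3 * Q) * (3 / 2 * L) := by
          refine mul_le_mul ?_ ?_ (by positivity) (by positivity) <;> linarith
      _ = L * Q := by ring
      _ ≤ (h : ℝ) + 1 := by linarith
  have g3 : (σmax - σmin) * gain h ≤ σ' * (E h - E L) := by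
    have e : (σmax - σmin) * gain h = σmin * ((σmax - σmin) / σmin * gain h) := by field_simp
    rw [e]
    have : 0 ≤ E h - E L :=
      (mul_nonneg (div_nonneg (by linarith) hσmin.le) g0).trans g2
    exact mul_le_mul hσm'.1 g2 (mul_nonneg (div_nonneg (by linarith) hσmin.le) g0) hσ0'.le
  have g4 : (σ - σ') * (E N - E h) ≤ (σmax - σmin) * gain h := by
    have e0 : 0 ≤ E N - E h :=
      sub_nonneg.2 (expectedMax_mono integrable_id_stdNormal (by lia) (by lia))
    calc _ ≤ (σmax - σmin) * (E N - E h) :=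
          mul_le_mul_of_nonneg_right (by linarith [hσm.2, hσm'.1]) e0
      _ ≤ _ := mul_le_mul_of_nonneg_left g1 (by linarith)
  have e4 : 4 * B * D * Q / N = 2 * B * D * Q / N + 2 * B * D * Q / N := by ring
  rw [e4]
  linarith

/-! ### Runs of the two search algorithms -/

section Kernels

variable {A B : Type*} [MeasurableSpace A] [MeasurableSpace B]

lemma integrable_compProd_of_bound {P : Measure A} [IsProbabilityMeasure P] {κ : Kernel A B}
    [IsMarkovKernel κ] {f : A × B → ℝ} (hf : Measurable f) {C : ℝ}
    (h : ∀ᵐ a ∂P, Integrable (fun b => f (a, b)) (κ a) ∧ ∫ b, |f (a, b)| ∂(κ a) ≤ C) :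
    Integrable f (P ⊗ₘ κ) := by
  rw [Measure.integrable_compProd_iff hf.aestronglyMeasurable]
  refine ⟨h.mono fun a ha => ha.1, ?_⟩
  refine Integrable.of_bound
    (hf.norm.stronglyMeasurable.integral_kernel_prod_right').aestronglyMeasurable C ?_
  filter_upwards [h] with a ha
  rw [Real.norm_eq_abs, abs_of_nonneg (integral_nonneg fun _ => norm_nonneg _)]
  exact ha.2

lemma ae_fst_compProd {P : Measure A} [IsProbabilityMeasure P] {κ : Kernel A B}
    [IsMarkovKernel κ] {p : A → Prop} (h : ∀ᵐ a ∂P, p a) : ∀ᵐ x ∂(P ⊗ₘ κ), p x.1 := by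
  refine ae_of_ae_map measurable_fst.aemeasurable ?_
  rw [← Measure.fst, Measure.fst_compProd]
  exact h

lemma integrable_fst_compProd {P : Measure A} [IsProbabilityMeasure P] {κ : Kernel A B}
    [IsMarkovKernel κ] {f : A → ℝ} (h : Integrable f P) :
    Integrable (fun x : A × B => f x.1) (P ⊗ₘ κ) := by
  have e : (P ⊗ₘ κ).map Prod.fst = P := by rw [← Measure.fst, Measure.fst_compProd]
  exact (e.symm ▸ h : Integrable f ((P ⊗ₘ κ).map Prod.fst)).comp_measurable measurable_fst

lemma integrable_integral_of_compProd {P : Measure A} [IsProbabilityMeasure P] {κ : Kernel A B}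
    [IsMarkovKernel κ] {f : A × B → ℝ} (hf : Measurable f) (hi : Integrable f (P ⊗ₘ κ)) :
    Integrable (fun a => ∫ b, f (a, b) ∂(κ a)) P :=
  ((Measure.integrable_compProd_iff hf.aestronglyMeasurable).1 hi).2.mono'
    hf.stronglyMeasurable.integral_kernel_prod_right'.aestronglyMeasurable
    (by filter_upwards with a using norm_integral_le_integral_norm _)

lemma ae_pi_forall {P : Measure A} [IsProbabilityMeasure P] {n : ℕ} {p : A → Prop}
    (h : ∀ᵐ a ∂P, p a) : ∀ᵐ x ∂(Measure.pi fun _ : Fin n => P), ∀ i, p (x i) :=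
  ae_all_iff.2 fun i =>
    (measurePreserving_eval (fun _ : Fin n => P) i).quasiMeasurePreserving.ae h

end Kernels

section Runs

variable {S : Type u} {Y : Type v} [MeasurableSpace S] [MeasurableSpace Y] (M : Model S Y)

lemma Model.rewardDist_apply (s : S) : M.rewardDist s = (M.response s).map M.reward :=
  Kernel.map_apply _ M.measurable_reward s

lemma Model.rollouts_apply (n : ℕ) (s : S) :
    M.rollouts n s = Measure.pi fun _ : Fin n => M.response s := rfl

/-- The largest reward among `n` responses. -/
noncomputable def Model.best {n : ℕ} (w : Fin n → Y) : ℝ := ⨆ k, M.reward (w k)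

lemma Model.measurable_best (n : ℕ) : Measurable (M.best : (Fin n → Y) → ℝ) :=
  Measurable.iSup fun k => M.measurable_reward.comp (measurable_pi_apply k)

lemma Model.abs_best_le {n : ℕ} (w : Fin n → Y) : |M.best w| ≤ ∑ k, |M.reward (w k)| :=
  abs_iSup_le_sum fun k => M.reward (w k)

lemma Model.integral_best (n : ℕ) (s : S) : ∫ w, M.best w ∂(M.rollouts n s) = M.value n s := by
  have hm : Measurable fun (w : Fin n → Y) k => M.reward (w k) :=
    measurable_pi_lambda _ fun k => M.measurable_reward.comp (measurable_pi_apply k)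
  rw [Model.value, expectedMax, M.rewardDist_apply, pi_map_comp _ M.measurable_reward,
    integral_map hm.aemeasurable (measurable_iSup_fin n).aestronglyMeasurable]
  rfl

/-- The rewards from the state `s` are integrable with absolute mean at most `C`. -/
def Model.MeanBound (C : ℝ) (s : S) : Prop :=
  Integrable (fun x : ℝ => x) (M.rewardDist s) ∧ ∫ x, |x| ∂(M.rewardDist s) ≤ C

variable {M} {C : ℝ}

lemma Model.MeanBound.integrable_reward {s : S} (h : M.MeanBound C s) :
    Integrable M.reward (M.response s) := by
  have h1 := h.1
  rw [M.rewardDist_apply] at h1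
  exact h1.comp_measurable M.measurable_reward

lemma Model.MeanBound.integral_abs_reward {s : S} (h : M.MeanBound C s) :
    ∫ y, |M.reward y| ∂(M.response s) ≤ C := by
  have h2 := h.2
  rwa [M.rewardDist_apply, integral_map M.measurable_reward.aemeasurable (by fun_prop)] at h2

lemma Model.MeanBound.abs_value_le {s : S} (h : M.MeanBound C s) (n : ℕ) :
    |M.value n s| ≤ n * C :=
  (abs_expectedMax_le h.1 n).trans (mul_le_mul_of_nonneg_left h.2 (Nat.cast_nonneg n))

lemma Model.MeanBound.rollouts {s : S} (h : M.MeanBound C s) (n : ℕ) :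
    Integrable (fun w : Fin n → Y => ∑ k, |M.reward (w k)|) (M.rollouts n s) ∧
      ∫ w, ∑ k, |M.reward (w k)| ∂(M.rollouts n s) ≤ n * C := by
  have hi : ∀ k : Fin n, Integrable (fun w : Fin n → Y => |M.reward (w k)|) (M.rollouts n s) :=
    fun k => integrable_comp_eval (μ := fun _ : Fin n => M.response s) (i := k)
      (f := fun y => |M.reward y|) h.integrable_reward.abs
  refine ⟨integrable_finsetSum _ fun k _ => hi k, ?_⟩
  rw [integral_finsetSum _ fun k _ => hi k]
  refine (Finset.sum_le_sum (g := fun _ => C) fun k _ => ?_).trans_eq (by simp)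
  rw [M.rollouts_apply, integral_comp_eval (μ := fun _ : Fin n => M.response s)
    (f := fun y => |M.reward y|) h.integrable_reward.abs.aestronglyMeasurable]
  exact h.integral_abs_reward

lemma Model.MeanBound.best {s : S} (h : M.MeanBound C s) (n : ℕ) :
    Integrable (M.best : (Fin n → Y) → ℝ) (M.rollouts n s) ∧
      ∫ w, |M.best w| ∂(M.rollouts n s) ≤ n * C := by
  obtain ⟨h1, h2⟩ := h.rollouts n
  have hi : Integrable (M.best : (Fin n → Y) → ℝ) (M.rollouts n s) :=
    h1.mono' (M.measurable_best n).aestronglyMeasurable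
      (by filter_upwards with w using M.abs_best_le w)
  exact ⟨hi, (integral_mono hi.abs h1 M.abs_best_le).trans h2⟩

/-- A last round of `n` responses from a state that depends on what happened before: the expected
largest reward is the mean of the value `V_n` at that state. -/
lemma integral_best_compProd {A : Type*} [MeasurableSpace A] {P : Measure A}
    [IsProbabilityMeasure P] {g : A → S} (hg : Measurable g) (n : ℕ)
    (h : ∀ᵐ a ∂P, M.MeanBound C (g a)) :
    Integrable (fun x : A × (Fin n → Y) => M.best x.2) (P ⊗ₘ (M.rollouts n).comap g hg) ∧
      ∫ x, M.best x.2 ∂(P ⊗ₘ (M.rollouts n).comap g hg) = ∫ a, M.value n (g a) ∂P := by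
  have hi : Integrable (fun x : A × (Fin n → Y) => M.best x.2)
      (P ⊗ₘ (M.rollouts n).comap g hg) :=
    integrable_compProd_of_bound ((M.measurable_best n).comp measurable_snd) (C := n * C) (by
      filter_upwards [h] with a ha
      rw [Kernel.comap_apply]
      exact ha.best n)
  refine ⟨hi, ?_⟩
  rw [Measure.integral_compProd hi]
  simp_rw [Kernel.comap_apply, M.integral_best]

lemma integrable_value_comp {A : Type*} [MeasurableSpace A] {P : Measure A}
    [IsProbabilityMeasure P] {g : A → S} (hg : Measurable g) (n : ℕ)
    (h : ∀ᵐ a ∂P, M.MeanBound C (g a)) : Integrable (fun a => M.value n (g a)) P :=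
  Integrable.of_bound ((M.measurable_value n).comp hg).aestronglyMeasurable (n * C) (by
    filter_upwards [h] with a ha using ha.abs_value_le n)

lemma Model.oracleBest_eq {n : ℕ} (ω : (Fin n → S) × (Fin n → Y)) :
    M.oracleBest ω = M.best ω.2 := by
  rw [Model.oracleBest, ← range_comp, sSup_range]
  rfl

lemma integral_oracleBest {n : ℕ} {sel : (Fin n → ℝ) → Fin n} (hsel : IsArgmax sel)
    (h : ∀ᵐ s ∂M.stateLaw, M.MeanBound C s) :
    Integrable M.oracleBest (M.oracleRun n hsel) ∧
      ∫ ω, M.oracleBest ω ∂(M.oracleRun n hsel) =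
        ∫ s, M.value n (s (M.oracleIndex sel s)) ∂(Measure.pi fun _ : Fin n => M.stateLaw) := by
  have e : (M.oracleBest : ((Fin n → S) × (Fin n → Y)) → ℝ) = fun ω => M.best ω.2 :=
    funext fun ω => M.oracleBest_eq ω
  rw [e]
  exact integral_best_compProd (C := C)
    (measurable_eval_index measurable_id (M.measurable_oracleIndex hsel)) n
    ((ae_pi_forall h).mono fun s hs => hs _)

/-- The largest reward of a run, as a supremum over the disjoint union of the two rounds. -/
lemma Model.slgBest_eq {K m n : ℕ} (ω : ((Fin K → S) × (Fin K → Fin m → Y)) × (Fin n → Y)) :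
    M.slgBest ω = ⨆ x : (Fin K × Fin m) ⊕ Fin n,
      M.reward (Sum.elim (fun p => ω.1.2 p.1 p.2) ω.2 x) := by
  rw [Model.slgBest, ← Sum.elim_range, ← range_comp, sSup_range]
  rfl

lemma Model.measurable_slgBest (K m n : ℕ) :
    Measurable (M.slgBest : ((Fin K → S) × (Fin K → Fin m → Y)) × (Fin n → Y) → ℝ) := by
  have e : (M.slgBest : ((Fin K → S) × (Fin K → Fin m → Y)) × (Fin n → Y) → ℝ) = fun ω =>
      ⨆ x : (Fin K × Fin m) ⊕ Fin n, M.reward (Sum.elim (fun p => ω.1.2 p.1 p.2) ω.2 x) :=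
    funext fun ω => M.slgBest_eq ω
  rw [e]
  refine Measurable.iSup fun x => M.measurable_reward.comp ?_
  rcases x with p | k
  · exact (measurable_pi_apply p.2).comp ((measurable_pi_apply p.1).comp
      (measurable_snd.comp measurable_fst))
  · exact (measurable_pi_apply k).comp measurable_snd

lemma Model.best_le_slgBest {K m n : ℕ} (hn : n ≠ 0)
    (ω : ((Fin K → S) × (Fin K → Fin m → Y)) × (Fin n → Y)) : M.best ω.2 ≤ M.slgBest ω := by
  have : Nonempty (Fin n) := ⟨⟨0, Nat.pos_of_ne_zero hn⟩⟩
  rw [M.slgBest_eq]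
  set f := fun x : (Fin K × Fin m) ⊕ Fin n =>
    M.reward (Sum.elim (fun p => ω.1.2 p.1 p.2) ω.2 x)
  exact ciSup_le fun k => le_ciSup (f := f) (finite_range f).bddAbove (Sum.inr k)

lemma Model.abs_slgBest_le {K m n : ℕ} (hn : n ≠ 0)
    (ω : ((Fin K → S) × (Fin K → Fin m → Y)) × (Fin n → Y)) :
    |M.slgBest ω| ≤ ∑ i, ∑ j, |M.reward (ω.1.2 i j)| + ∑ k, |M.reward (ω.2 k)| := by
  have : Nonempty (Fin n) := ⟨⟨0, Nat.pos_of_ne_zero hn⟩⟩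
  rw [M.slgBest_eq]
  obtain ⟨x, hx⟩ := exists_eq_ciSup_of_finite (f := fun x : (Fin K × Fin m) ⊕ Fin n =>
    M.reward (Sum.elim (fun p => ω.1.2 p.1 p.2) ω.2 x))
  rw [← hx, ← Fintype.sum_prod_type' (f := fun i j => |M.reward (ω.1.2 i j)|)]
  have h1 : 0 ≤ ∑ p : Fin K × Fin m, |M.reward (ω.1.2 p.1 p.2)| :=
    Finset.sum_nonneg fun _ _ => abs_nonneg _
  have h2 : 0 ≤ ∑ k, |M.reward (ω.2 k)| := Finset.sum_nonneg fun _ _ => abs_nonneg _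
  rcases x with p | k
  · have := Finset.single_le_sum (f := fun p : Fin K × Fin m => |M.reward (ω.1.2 p.1 p.2)|)
      (fun _ _ => abs_nonneg _) (Finset.mem_univ p)
    simp only [Sum.elim_inl]
    linarith
  · have := Finset.single_le_sum (f := fun k => |M.reward (ω.2 k)|)
      (fun _ _ => abs_nonneg _) (Finset.mem_univ k)
    simp only [Sum.elim_inr]
    linarith

lemma integrable_pilot {K m : ℕ} {s : Fin K → S} (h : ∀ i, M.MeanBound C (s i)) :
    Integrable (fun y : Fin K → Fin m → Y => ∑ i, ∑ j, |M.reward (y i j)|) (M.pilot K m s) ∧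
      ∫ y, ∑ i, ∑ j, |M.reward (y i j)| ∂(M.pilot K m s) ≤ K * (m * C) := by
  have hi : ∀ i, Integrable (fun y : Fin K → Fin m → Y => ∑ j, |M.reward (y i j)|)
      (M.pilot K m s) := fun i =>
    integrable_comp_eval (μ := fun i => M.rollouts m (s i)) (i := i)
      (f := fun w : Fin m → Y => ∑ j, |M.reward (w j)|) ((h i).rollouts m).1
  refine ⟨integrable_finsetSum _ fun i _ => hi i, ?_⟩
  rw [integral_finsetSum _ fun i _ => hi i]
  refine (Finset.sum_le_sum (g := fun _ => m * C) fun i _ => ?_).trans_eq (by simp)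
  refine le_trans (le_of_eq ?_) ((h i).rollouts m).2
  exact integral_comp_eval (μ := fun i => M.rollouts m (s i)) (i := i)
    (f := fun w : Fin m → Y => ∑ j, |M.reward (w j)|) ((h i).rollouts m).1.aestronglyMeasurable

/-- The value of SLG search is at least the mean value `V_n` of the selected state, where `n` is the
number of responses of the last round: the pilot rewards only help. -/
lemma integral_slgBest (α : ℝ) {N K m : ℕ} {sel : (Fin K → ℝ) → Fin K} (hsel : IsArgmax sel)
    (hn : N - K * m ≠ 0) (h : ∀ᵐ s ∂M.stateLaw, M.MeanBound C s) :
    Integrable M.slgBest (M.slgRun α N K m hsel) ∧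
    Integrable (fun s => ∫ y, M.value (N - K * m) (s (M.slgIndex α N sel y)) ∂(M.pilot K m s))
      (Measure.pi fun _ : Fin K => M.stateLaw) ∧
      ∫ s, ∫ y, M.value (N - K * m) (s (M.slgIndex α N sel y)) ∂(M.pilot K m s)
        ∂(Measure.pi fun _ : Fin K => M.stateLaw) ≤
          ∫ ω, M.slgBest ω ∂(M.slgRun α N K m hsel) := by
  have hs := ae_pi_forall (n := K) h
  have hp : ∀ᵐ p ∂((Measure.pi fun _ : Fin K => M.stateLaw) ⊗ₘ M.pilot K m),
      ∀ i, M.MeanBound C (p.1 i) := ae_fst_compProd hs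
  have hg : Measurable fun p : (Fin K → S) × (Fin K → Fin m → Y) =>
      p.1 (M.slgIndex α N sel p.2) := measurable_eval_index measurable_fst
        ((M.measurable_slgIndex α N hsel).comp measurable_snd)
  have hpg := hp.mono fun p hp => hp (M.slgIndex α N sel p.2)
  obtain ⟨i1, e1⟩ := integral_best_compProd hg (N - K * m) hpg
  have hpil : Measurable fun p : (Fin K → S) × (Fin K → Fin m → Y) =>
      ∑ i, ∑ j, |M.reward (p.2 i j)| :=
    Finset.measurable_fun_sum _ fun i _ => Finset.measurable_fun_sum _ fun j _ =>
      (M.measurable_reward.comp ((measurable_pi_apply j).comp ((measurable_pi_apply i).comp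
        measurable_snd))).abs
  have i2 : Integrable (fun p : (Fin K → S) × (Fin K → Fin m → Y) =>
      ∑ i, ∑ j, |M.reward (p.2 i j)|) ((Measure.pi fun _ : Fin K => M.stateLaw) ⊗ₘ M.pilot K m) :=
    integrable_compProd_of_bound hpil (C := K * (m * C)) (by
      filter_upwards [hs] with s hs
      obtain ⟨h1, h2⟩ := integrable_pilot (m := m) hs
      refine ⟨h1, le_trans (le_of_eq ?_) h2⟩
      refine integral_congr_ae ?_
      filter_upwards with y
      exact abs_of_nonneg (Finset.sum_nonneg fun _ _ => Finset.sum_nonneg fun _ _ => abs_nonneg _))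
  have i3 : Integrable (fun ω : ((Fin K → S) × (Fin K → Fin m → Y)) × (Fin (N - K * m) → Y) =>
      ∑ k, |M.reward (ω.2 k)|) (M.slgRun α N K m hsel) :=
    integrable_compProd_of_bound
      (Finset.measurable_fun_sum _ fun k _ =>
        (M.measurable_reward.comp ((measurable_pi_apply k).comp measurable_snd)).abs)
      (C := (N - K * m : ℕ) * C) (by
        filter_upwards [hpg] with p hp
        obtain ⟨h1, h2⟩ := hp.rollouts (N - K * m)
        rw [Kernel.comap_apply]
        refine ⟨h1, le_trans (le_of_eq ?_) h2⟩
        refine integral_congr_ae ?_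
        filter_upwards with y
        exact abs_of_nonneg (Finset.sum_nonneg fun _ _ => abs_nonneg _))
  have i4 : Integrable M.slgBest (M.slgRun α N K m hsel) :=
    ((integrable_fst_compProd i2).add i3).mono' (M.measurable_slgBest K m _).aestronglyMeasurable
      (by filter_upwards with ω using M.abs_slgBest_le hn ω)
  have i5 := integrable_value_comp hg (N - K * m) hpg
  refine ⟨i4, ?_, ?_⟩
  · exact integrable_integral_of_compProd ((M.measurable_value _).comp hg) i5
  · rw [← Measure.integral_compProd i5, ← e1]
    exact integral_mono i1 i4 fun ω => M.best_le_slgBest hn ω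

end Runs

/-! ### Regret of SLG search -/

section Regret

variable {S : Type u} {Y : Type v} [MeasurableSpace S] [MeasurableSpace Y] {M : Model S Y}

/-- The probability that some pilot prediction misses its target by more than `ε`. -/
lemma pilot_union_bound (α : ℝ) (N : ℕ) {K m : ℕ} (s : Fin K → S) (v : Fin K → ℝ) (ε δ : ℝ)
    (h : ∀ i, (Measure.pi fun _ : Fin m => M.rewardDist (s i)).real
      {d | ε < |predict α N d - v i|} ≤ δ) :
    MeasurableSet {y : Fin K → Fin m → Y |
      ∃ i, ε < |predict α N (fun j => M.reward (y i j)) - v i|} ∧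
    (M.pilot K m s).real {y | ∃ i, ε < |predict α N (fun j => M.reward (y i j)) - v i|} ≤
      K * δ := by
  have hr : Measurable fun (w : Fin m → Y) j => M.reward (w j) :=
    measurable_pi_lambda _ fun j => M.measurable_reward.comp (measurable_pi_apply j)
  have hb : ∀ i, MeasurableSet {d : Fin m → ℝ | ε < |predict α N d - v i|} := fun i =>
    measurableSet_lt measurable_const ((measurable_predict α N).sub_const _).abs
  have e : {y : Fin K → Fin m → Y | ∃ i, ε < |predict α N (fun j => M.reward (y i j)) - v i|} =
      ⋃ i, (fun y => y i) ⁻¹' ((fun (w : Fin m → Y) j => M.reward (w j)) ⁻¹'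
        {d | ε < |predict α N d - v i|}) := by
    ext y
    simp
  rw [e]
  refine ⟨MeasurableSet.iUnion fun i => measurable_pi_apply i (hr (hb i)), ?_⟩
  refine (measureReal_iUnion_fintype_le _).trans ?_
  refine (Finset.sum_le_sum (g := fun _ => δ) fun i _ => ?_).trans_eq (by simp)
  refine le_trans (le_of_eq ?_) (h i)
  have h1 := (measurePreserving_eval (fun i => M.rollouts m (s i)) i).map_eq
  rw [M.rewardDist_apply, pi_map_comp _ M.measurable_reward, map_measureReal_apply hr (hb i),
    ← M.rollouts_apply, ← h1, map_measureReal_apply (measurable_pi_apply i) (hr (hb i))]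
  rfl

/-- A random variable that is at least `a` off an event and at least `a - L` on it has mean at
least `a - L` times the probability of the event. -/
lemma sub_mul_measureReal_le_integral {Ω : Type*} [MeasurableSpace Ω] {P : Measure Ω}
    [IsProbabilityMeasure P] {X : Ω → ℝ} (hX : Integrable X P) {s : Set Ω} (hs : MeasurableSet s)
    {a L : ℝ} (hout : ∀ ω ∉ s, a ≤ X ω) (hin : ∀ ω ∈ s, a - L ≤ X ω) :
    a - L * P.real s ≤ ∫ ω, X ω ∂P := by
  have hi : Integrable (s.indicator fun _ : Ω => L) P := (integrable_const L).indicator hs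
  calc a - L * P.real s = ∫ ω, (a - s.indicator (fun _ => L) ω) ∂P := by
        rw [integral_sub (integrable_const a) hi, integral_indicator_const L hs]
        simp [mul_comm]
    _ ≤ ∫ ω, X ω ∂P := by
        refine integral_mono ((integrable_const a).sub hi) hX fun ω => ?_
        by_cases hω : ω ∈ s
        · simpa [hω] using hin ω hω
        · simpa [hω] using hout ω hω

end Regret

end SLG

theorem theorem2 (α σmin σmax CR Mμ : ℝ) (hα0 : 0 < α) (hα1 : α < 1)
    (hσmin : 0 < σmin) (hσ : σmin ≤ σmax) :
    ∃ c₀ : ℝ, 0 < c₀ ∧ ∃ c : ℝ, 0 < c ∧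
      ∀ (S : Type u) (Y : Type v) [MeasurableSpace S] [MeasurableSpace Y] (M : SLG.Model S Y)
        (μ σ : S → ℝ), M.UniformGaussianTail α σmin σmax CR Mμ μ σ →
      ∀ (N m : ℕ), 4 * (m + 1) ≤ N → c₀ * Real.log N ≤ m →
      ∀ (sel selStar : (Fin (N / (2 * m)) → ℝ) → Fin (N / (2 * m)))
        (hsel : SLG.IsArgmax sel) (hselStar : SLG.IsArgmax selStar),
        Integrable M.slgBest (M.slgRun α N (N / (2 * m)) m hsel) ∧
        Integrable M.oracleBest (M.oracleRun (N / (2 * m)) hselStar) ∧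
        (∫ ω, M.oracleBest ω ∂(M.oracleRun (N / (2 * m)) hselStar)) -
            c * (Real.log N / Real.sqrt m) ≤
          ∫ ω, M.slgBest ω ∂(M.slgRun α N (N / (2 * m)) m hsel) := by
  have hσmax : 0 < σmax := hσmin.trans_le hσ
  obtain ⟨Q, hQ, C₁, hC₁, hcomp⟩ :=
    SLG.exists_value_comparison (CR := |CR|) hα0 hα1 hσmin hσ (abs_nonneg CR)
  obtain ⟨a₀, ha₀, C₂, hC₂, hacc⟩ := SLG.exists_predict_accuracy hα0 hα1 hσmax
  have hB0 : 0 < 1 + |CR| := by positivity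
  -- `2 * Q` in `c₀` forces `Q ≤ m`, since `log N ≥ 1 / 2`
  refine ⟨a₀ + 2 * Q, by positivity, 2 * C₂ + C₁ + 24 * (1 + |CR|), by positivity, ?_⟩
  intro S Y _ _ M μ σ hM N m hN hm
  generalize hK : N / (2 * m) = K
  intro sel selStar hsel hselStar
  -- elementary consequences of `4 * (m + 1) ≤ N` and `c₀ * log N ≤ m`
  have hN4 : (4 : ℝ) ≤ N := by exact_mod_cast (by lia : 4 ≤ N)
  have hlog2 : Real.log 2 ≤ Real.log N := Real.log_le_log (by norm_num) (by linarith)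
  have hl2 := Real.log_two_gt_d9
  have hlog : 1 / 2 ≤ Real.log N := by linarith
  have hQr : (0 : ℝ) < Q := by exact_mod_cast hQ
  have hQm : Q ≤ m := by
    have : (Q : ℝ) ≤ m := by nlinarith
    exact_mod_cast this
  have ham : a₀ * Real.log N ≤ m := by nlinarith
  have hm0 : 0 < m := by lia
  have hmr : (1 : ℝ) ≤ m := by exact_mod_cast hm0
  have hmN : 4 * (m : ℝ) ≤ N := by exact_mod_cast (by lia : 4 * m ≤ N)
  have hK0 : K ≠ 0 := by
    have : 0 < N / (2 * m) := Nat.div_pos (by lia) (by lia)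
    lia
  have hKN : K ≤ N := hK ▸ Nat.div_le_self _ _
  have hKQ : K ≤ N / (2 * Q) := hK ▸ Nat.div_le_div_left (by lia) (by lia)
  have hKm : 2 * (K * m) ≤ N := by
    have := Nat.div_mul_le_self N (2 * m)
    rw [hK] at this
    lia
  have hn2 : N / 2 ≤ N - K * m := by lia
  have hn0 : N - K * m ≠ 0 := by lia
  have hnN : N - K * m ≤ N := Nat.sub_le _ _
  set n := N - K * m with hn
  have hrate : 1 / (N : ℝ) ≤ Real.log N / √m := by
    rw [div_le_div_iff₀ (by positivity) (by positivity), one_mul]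
    have : √(m : ℝ) ≤ m := Real.sqrt_le_iff.2 ⟨by linarith, by nlinarith⟩
    nlinarith
  -- the properties of almost every state
  have hgood : ∀ᵐ s ∂M.stateLaw, SLG.GaussianTail α |CR| (M.rewardDist s) (μ s) (σ s) ∧
      σ s ∈ Set.Icc σmin σmax := by
    filter_upwards [hM.tail, hM.sigma_mem] with s h1 h2
    exact ⟨h1.mono (le_abs_self CR), h2⟩
  have hmean : ∀ᵐ s ∂M.stateLaw, M.MeanBound (1 + |CR|) s := by
    filter_upwards [hgood] with s hs
    exact ⟨hs.1.integrable_id, hs.1.integral_abs_le⟩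
  obtain ⟨iO, eO⟩ := SLG.integral_oracleBest hselStar hmean
  obtain ⟨iS, iV, leS⟩ := SLG.integral_slgBest α hsel hn0 hmean
  refine ⟨iS, iO, ?_⟩
  rw [eO]
  refine le_trans ?_ leS
  set err := (2 * C₂ + C₁ + 24 * (1 + |CR|)) * (Real.log N / √m) with herr
  have iOv : Integrable (fun s => M.value K (s (M.oracleIndex selStar s)))
      (Measure.pi fun _ : Fin K => M.stateLaw) :=
    SLG.integrable_value_comp (C := 1 + |CR|)
      (SLG.measurable_eval_index measurable_id (M.measurable_oracleIndex hselStar)) K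
      ((SLG.ae_pi_forall hmean).mono fun s hs => hs _)
  have hconst : err = ∫ _ : Fin K → S, err ∂(Measure.pi fun _ : Fin K => M.stateLaw) := by simp
  rw [hconst, ← integral_sub iOv (integrable_const _)]
  refine integral_mono_ae (iOv.sub (integrable_const _)) iV ?_
  filter_upwards [SLG.ae_pi_forall hgood, SLG.ae_pi_forall hmean] with s hs hsm
  -- for fixed states, compare the state with the largest prediction to the oracle's choice `i'`
  set i' := M.oracleIndex selStar s with hi'
  set ε := C₂ * (Real.log N / √m) with hε
  set E := SLG.expectedMax (gaussianReal 0 1) N with hE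
  set v := fun i => μ (s i) + σ (s i) * E with hv
  obtain ⟨hbadm, hbad⟩ := SLG.pilot_union_bound (M := M) α N s v ε (12 / (N : ℝ) ^ 3) fun i =>
    hacc |CR| (M.rewardDist (s i)) (μ (s i)) (σ (s i)) (hs i).1
      (hσmin.trans_le (hs i).2.1) (hs i).2.2 N m (by lia) ham
  set bad := {y : Fin K → Fin m → Y |
    ∃ i, ε < |SLG.predict α N (fun j => M.reward (y i j)) - v i|} with hbaddef
  have hbound : ∀ k ≤ N, ∀ i, |M.value k (s i)| ≤ N * (1 + |CR|) := fun k hk i =>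
    ((hsm i).abs_value_le k).trans
      (mul_le_mul_of_nonneg_right (by exact_mod_cast hk) hB0.le)
  have hXi : Integrable (fun y => M.value n (s (M.slgIndex α N sel y))) (M.pilot K m s) := by
    have : Measurable fun y : Fin K → Fin m → Y => M.value n (s (M.slgIndex α N sel y)) :=
      (measurable_of_finite fun i => M.value n (s i)).comp (M.measurable_slgIndex α N hsel)
    refine Integrable.of_bound this.aestronglyMeasurable (N * (1 + |CR|)) ?_
    filter_upwards with y using hbound n hnN _
  have hC₁N : C₁ / N ≤ C₁ * (Real.log N / √m) := by
    have := mul_le_mul_of_nonneg_left hrate hC₁.le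
    rwa [mul_one_div] at this
  have hε0 : 0 ≤ ε := by positivity
  have key := SLG.sub_mul_measureReal_le_integral hXi hbadm
    (a := M.value K (s i') - C₁ / N - 2 * ε) (L := 2 * (N * (1 + |CR|)))
    (fun y hy => by
      simp only [hbaddef, Set.mem_ofPred_eq, not_exists, not_lt] at hy
      set i := M.slgIndex α N sel y with hi
      have h1 := (abs_le.1 (hy i)).2
      have h2 := (abs_le.1 (hy i')).1
      have h3 : SLG.predict α N (fun j => M.reward (y i' j)) ≤
          SLG.predict α N (fun j => M.reward (y i j)) :=
        hsel.le_apply (fun i => SLG.predict α N fun j => M.reward (y i j)) i'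
      have h4 := hcomp (M.rewardDist (s i)) (M.rewardDist (s i')) (μ (s i)) (σ (s i))
        (μ (s i')) (σ (s i')) (hs i).1 (hs i').1 (hs i).2 (hs i').2 N K n (by lia) hK0 hKQ hn2
      simp only [SLG.Model.value, hv] at h1 h2 ⊢
      linarith)
    (fun y _ => by
      have h1 := (abs_le.1 (hbound n hnN (M.slgIndex α N sel y))).1
      have h2 := (abs_le.1 (hbound K hKN i')).2
      have h3 : 0 ≤ C₁ / N := by positivity
      linarith)
  have hloss : 2 * (N * (1 + |CR|)) * (M.pilot K m s).real bad ≤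
      24 * (1 + |CR|) * (Real.log N / √m) := by
    have hKr : (K : ℝ) ≤ N := by exact_mod_cast hKN
    calc 2 * (N * (1 + |CR|)) * (M.pilot K m s).real bad
        ≤ 2 * (N * (1 + |CR|)) * (N * (12 / (N : ℝ) ^ 3)) := by
          refine mul_le_mul_of_nonneg_left (hbad.trans ?_) (by positivity)
          exact mul_le_mul_of_nonneg_right hKr (by positivity)
      _ = 24 * (1 + |CR|) * (1 / N) := by
          field_simp
          norm_num
      _ ≤ _ := mul_le_mul_of_nonneg_left hrate (by positivity)
  refine le_trans ?_ key
  have e : err = 2 * ε + C₁ * (Real.log N / √m) + 24 * (1 + |CR|) * (Real.log N / √m) := by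
    rw [herr, hε]
    ring
  simp only [e]
  linarith
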